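/- Let $\alpha\in(0,1)$. For $0\le y\le p$ put \[ M_1(p,y)=\frac1{\Gamma(1-\alpha)}\int_y^p\bigl(1-p^{-2/\alpha}\mu^{2/\alpha}\bigr)^{-\alpha}d\mu,\qquad M_n(p,y)=\int_y^p M_1(a,y)\,M_{n-1}(p,a)\,da\quad(n\ge2), \] \[ N(p,y)=\sum_{n=1}^\infty M_n(p,y),\qquad H(p,x)=1+\int_x^p N(p,y)\,dy\quad(0\le x\le p), \] and for $c>0$, $0\le y\le c$, put $G_c(y)=\frac1{\Gamma(1-\alpha)}\int_y^c(1-c^{-2/\alpha}\mu^{2/\alpha})^{-\alpha}d\mu$. For every $R>0$ the series defining $N$ converges uniformly on $W_R=\{(p,y):0\le y\le p\le R\}$, and the functions $M_n$ ($n\ge1$) and $N$ are positive on $\{(p,y):0\le y<p\}$. For every $\gamma>0$ there is a constant $c_1=c_1(\alpha,\gamma)>0$ and a pair $(u,s)$ with $s(t)=c_1t^{\alpha/2}$ for $t\ge0$ and \[ u(x,t)=\int_{xt^{-\alpha/2}}^{c_1}H(p,xt^{-\alpha/2})\,G_{c_1}(p)\,dp\qquad(t>0,\ 0\le x\le s(t)),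 \] which solves the time-fractional one-phase Stefan problem in $U=\{(x,t):t>0,\ 0<x<s(t)\}$: \[ D^\alpha_{s^{-1}(x)}u(x,t)=u_{xx}(x,t)-\frac{1}{\Gamma(1-\alpha)}(t-s^{-1}(x))^{-\alpha}\quad\text{in }U, \qquad u(s(t),t)=0,\qquad u(0,t)=\gamma, \] \[ \dot s(t)=-\frac1{\Gamma(\alpha)}\lim_{a\nearrow s(t)}\frac{d}{dt}\int_{s^{-1}(a)}^t(t-\tau)^{\alpha-1}u_x(a,\tau)\,d\tau\qquad(t>0), \] where $D^\alpha_{s^{-1}(x)}u(x,t)=\frac1{\Gamma(1-\alpha)}\int_{s^{-1}(x)}^t(t-\tau)^{-\alpha}u_t(x,\tau)\,d\tau$. Moreover: - $u>0$ in $U$; - $u(x,t)=u(\lambda^a x,\lambda^{2a/\alpha}t)$ for all $a,\lambda>0$, $t>0$, $0\le x\le s(t)$; - $u_x(s(t),t)=0$ for every $t>0$ (as the limit of $u_x(x,t)$ for $x\nearrow s(t)$, and as a one-sided derivative); - $u(\cdot,t)\in W^{2,1}(0,s(t))$ for every $t>0$; - $u_t(x,\cdot)\in C([s^{-1}(x),\infty))$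 for every $x>0$; - $u_x(x,\cdot)\in L^\infty(s^{-1}(x),\infty)\cap AC_{loc}([s^{-1}(x),\infty))$ for every $x>0$; - $u_t(\cdot,t)\in L^1(0,s(t))$ and $D^\alpha_{s^{-1}(\cdot)}u(\cdot,t)\in L^1(0,s(t))$ for every $t>0$. In particular, $(u,s)$ satisfies the following for every $t^*>0$. - (A1) $\dot s(t)>0$ for $t>0$. - (A2) $s\in AC[0,t^*]$; $u_x(x,\cdot)\in AC[s^{-1}(x),t^*]$ for every $x\in(0,s(t^*)]$; for every $t\in(0,t^*)$, $u_x(\cdot,t)\in AC[0,s(t)-\varepsilon]$ for every $\varepsilon\in(0,s(t))$, and $u_t(\cdot,t)\in L^1(0,s(t))$. - (A3) $\dot s\in L^\infty_{loc}((0,t^*])$, and $D^\alpha_{s^{-1}(\cdot)}u(\cdot,t)\in L^1(0,s(t))$ for every $t\in(0,t^*)$. -/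

import Mathlib

open Set Filter Topology MeasureTheory
open scoped ContDiff

noncomputable section

namespace FracStefan

/-! ### Explicit kernels -/

/-- The kernels `M_n(p,y)`, `n ≥ 1`, used for `0 ≤ y ≤ p`.  The index `0` is a dummy value. -/
def kernelM (α : ℝ) : ℕ → ℝ → ℝ → ℝ
  | 0 => fun _ _ => 0
  | 1 => fun p y =>
      1 / Real.Gamma (1 - α) * ∫ μ in y..p, (1 - p ^ (-(2 / α)) * μ ^ (2 / α)) ^ (-α)
  | n + 2 => fun p y => ∫ a in y..p, kernelM α 1 a y * kernelM α (n + 1) p a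

/-- `N(p,y) = ∑_{n ≥ 1} M_n(p,y)`. -/
def kernelN (α p y : ℝ) : ℝ := ∑' n : ℕ, kernelM α (n + 1) p y

/-- `H(p,x) = 1 + ∫_x^p N(p,y) dy`. -/
def kernelH (α p x : ℝ) : ℝ := 1 + ∫ y in x..p, kernelN α p y

/-- `G_c(y) = Γ(1-α)⁻¹ ∫_y^c (1 - c^{-2/α} μ^{2/α})^{-α} dμ`. -/
def sourceG (α c y : ℝ) : ℝ :=
  1 / Real.Gamma (1 - α) * ∫ μ in y..c, (1 - c ^ (-(2 / α)) * μ ^ (2 / α)) ^ (-α)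

/-- The self-similar temperature `∫_{x t^{-α/2}}^c H(p, x t^{-α/2}) G_c(p) dp`. -/
def selfSimilarTemp (α c x t : ℝ) : ℝ :=
  ∫ p in (x * t ^ (-(α / 2)))..c, kernelH α p (x * t ^ (-(α / 2))) * sourceG α c p

/-- The triangle `W_R = {(p,y) : 0 ≤ y ≤ p ≤ R}`. -/
def triangle (R : ℝ) : Set (ℝ × ℝ) := {q | 0 ≤ q.2 ∧ q.2 ≤ q.1 ∧ q.1 ≤ R}

/-! ### The moving domain, derivatives and fractional operators

A temperature is a function `u : ℝ → ℝ → ℝ`, written `u x t` (position, then time).  A front is a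
function `s : ℝ → ℝ`, of which only the values on `[0,∞)` matter.  Only the values of `u` on
`closedLiquid s` enter the notions below (for the fronts considered here). -/

/-- The open liquid region `{(x,t) : t > 0, 0 < x < s(t)}`. -/
def liquid (s : ℝ → ℝ) : Set (ℝ × ℝ) := {q | 0 < q.2 ∧ 0 < q.1 ∧ q.1 < s q.2}

/-- The liquid region with its lateral boundary, `{(x,t) : t > 0, 0 ≤ x ≤ s(t)}`. -/
def closedLiquid (s : ℝ → ℝ) : Set (ℝ × ℝ) := {q | 0 < q.2 ∧ 0 ≤ q.1 ∧ q.1 ≤ s q.2}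

/-- `s⁻¹(x)`: the time `t ≥ 0` with `s(t) = x`. -/
def frontTime (s : ℝ → ℝ) (x : ℝ) : ℝ := Function.invFunOn s (Ici 0) x

/-- `u_x(x,t)` for `0 ≤ x ≤ s(t)`; one-sided at the two end points, the ordinary partial
derivative for `0 < x < s(t)`. -/
def spaceDeriv (s : ℝ → ℝ) (u : ℝ → ℝ → ℝ) (x t : ℝ) : ℝ :=
  derivWithin (fun y => u y t) (Icc 0 (s t)) x

/-- `u_{xx}(x,t)`. -/
def spaceDeriv₂ (s : ℝ → ℝ) (u : ℝ → ℝ → ℝ) (x t : ℝ) : ℝ :=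
  derivWithin (fun y => spaceDeriv s u y t) (Icc 0 (s t)) x

/-- `u_t(x,t)` for `t ≥ s⁻¹(x)`; one-sided at `t = s⁻¹(x)`, the ordinary partial derivative for
`t > s⁻¹(x)`. -/
def timeDeriv (s : ℝ → ℝ) (u : ℝ → ℝ → ℝ) (x t : ℝ) : ℝ :=
  derivWithin (fun τ => u x τ) (Ici (frontTime s x)) t

/-- The Caputo derivative started at the melting time,
`D^α_{s⁻¹(x)} u(x,t) = Γ(1-α)⁻¹ ∫_{s⁻¹(x)}^t (t-τ)^{-α} u_t(x,τ) dτ`. -/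
def caputoFront (α : ℝ) (s : ℝ → ℝ) (u : ℝ → ℝ → ℝ) (x t : ℝ) : ℝ :=
  1 / Real.Gamma (1 - α) *
    ∫ τ in (frontTime s x)..t, (t - τ) ^ (-α) * timeDeriv s u x τ

/-- `∫_{s⁻¹(a)}^t (t-τ)^{α-1} u_x(a,τ) dτ`. -/
def memoryIntegral (α : ℝ) (s : ℝ → ℝ) (u : ℝ → ℝ → ℝ) (a t : ℝ) : ℝ :=
  ∫ τ in (frontTime s a)..t, (t - τ) ^ (α - 1) * spaceDeriv s u a τ

/-- `(u,s)` is a (classical) solution of the time-fractional one-phase Stefan problem with `s(0)=0`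
and Dirichlet datum `u(0,t) = γ`.  All derivatives and integrals occurring in the equations are
required to exist. -/
structure IsStefanSolution (α γ : ℝ) (u : ℝ → ℝ → ℝ) (s : ℝ → ℝ) : Prop where
  front_zero : s 0 = 0
  front_continuous : ContinuousOn s (Ici 0)
  front_strictMono : StrictMonoOn s (Ici 0)
  front_differentiable : ∀ t, 0 < t → DifferentiableAt ℝ s t
  temp_continuous : ContinuousOn (fun q : ℝ × ℝ => u q.1 q.2) (closedLiquid s)
  time_differentiable : ∀ x t, (x, t) ∈ liquid s → DifferentiableAt ℝ (fun τ => u x τ) t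
  space_differentiable : ∀ x t, (x, t) ∈ liquid s → DifferentiableAt ℝ (fun y => u y t) x
  space_differentiable₂ : ∀ x t, (x, t) ∈ liquid s →
    DifferentiableAt ℝ (fun y => spaceDeriv s u y t) x
  caputo_integrable : ∀ x t, (x, t) ∈ liquid s →
    IntervalIntegrable (fun τ => (t - τ) ^ (-α) * timeDeriv s u x τ) volume (frontTime s x) t
  /-- `D^α_{s⁻¹(x)} u = u_xx - Γ(1-α)⁻¹ (t - s⁻¹(x))^{-α}` in the liquid region. -/
  equation : ∀ x t, (x, t) ∈ liquid s →
    caputoFront α s u x t =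
      spaceDeriv₂ s u x t - 1 / Real.Gamma (1 - α) * (t - frontTime s x) ^ (-α)
  front_value : ∀ t, 0 < t → u (s t) t = 0
  dirichlet : ∀ t, 0 < t → u 0 t = γ
  memory_integrable : ∀ a t, (a, t) ∈ liquid s →
    IntervalIntegrable (fun τ => (t - τ) ^ (α - 1) * spaceDeriv s u a τ) volume (frontTime s a) t
  memory_differentiable : ∀ a t, (a, t) ∈ liquid s →
    DifferentiableAt ℝ (fun r => memoryIntegral α s u a r) t
  /-- `s'(t) = - Γ(α)⁻¹ lim_{a ↗ s(t)} d/dt ∫_{s⁻¹(a)}^t (t-τ)^{α-1} u_x(a,τ) dτ`. -/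
  stefan : ∀ t, 0 < t → ∃ l : ℝ,
    Tendsto (fun a => deriv (fun r => memoryIntegral α s u a r) t) (𝓝[<] (s t)) (𝓝 l) ∧
      deriv s t = -(1 / Real.Gamma α) * l

/-! ### Regularity classes -/

/-- `g` is the weak derivative of `f` on the interval `(a,b)`. -/
def IsWeakDeriv (a b : ℝ) (f g : ℝ → ℝ) : Prop :=
  ∀ φ : ℝ → ℝ, ContDiff ℝ ∞ φ → HasCompactSupport φ → tsupport φ ⊆ Ioo a b →
    ∫ x in Ioo a b, f x * deriv φ x = -∫ x in Ioo a b, g x * φ x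

/-- `f ∈ W^{2,1}(a,b)`. -/
def MemW21 (a b : ℝ) (f : ℝ → ℝ) : Prop :=
  IntegrableOn f (Ioo a b) ∧ ∃ g h : ℝ → ℝ,
    IntegrableOn g (Ioo a b) ∧ IntegrableOn h (Ioo a b) ∧
      IsWeakDeriv a b f g ∧ IsWeakDeriv a b g h

/-- Assumption (A1): the front advances, `s'(t) > 0`. -/
def AssumptionA1 (s : ℝ → ℝ) : Prop :=
  ∀ t, 0 < t → DifferentiableAt ℝ s t ∧ 0 < deriv s t

/-- Assumption (A2) on the time interval `[0,T]`: `s ∈ AC[0,T]`; `u_x(x,·) ∈ AC[s⁻¹(x),T]`;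
`u_x(·,t) ∈ AC[0,s(t)-ε]` for every `ε > 0`; `u_t(·,t) ∈ L¹(0,s(t))`. -/
structure AssumptionA2 (u : ℝ → ℝ → ℝ) (s : ℝ → ℝ) (T : ℝ) : Prop where
  front_ac : AbsolutelyContinuousOnInterval s 0 T
  space_differentiable : ∀ t ∈ Ioc 0 T, DifferentiableOn ℝ (fun y => u y t) (Icc 0 (s t))
  time_differentiable : ∀ t ∈ Ioo 0 T, ∀ x ∈ Ioo 0 (s t), DifferentiableAt ℝ (fun τ => u x τ) t
  ux_ac_time : ∀ x ∈ Ioc 0 (s T),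
    AbsolutelyContinuousOnInterval (fun τ => spaceDeriv s u x τ) (frontTime s x) T
  ux_ac_space : ∀ t ∈ Ioo 0 T, ∀ ε ∈ Ioo 0 (s t),
    AbsolutelyContinuousOnInterval (fun y => spaceDeriv s u y t) 0 (s t - ε)
  ut_integrable : ∀ t ∈ Ioo 0 T, IntegrableOn (fun x => timeDeriv s u x t) (Ioo 0 (s t))

/-- Assumption (A3) on the time interval `[0,T]`: `s' ∈ L^∞_loc((0,T])` and
`D^α_{s⁻¹(·)} u(·,t) ∈ L¹(0,s(t))`. -/
structure AssumptionA3 (α : ℝ) (u : ℝ → ℝ → ℝ) (s : ℝ → ℝ) (T : ℝ) : Prop where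
  front_deriv_bounded : ∀ δ ∈ Ioo 0 T, MemLp (deriv s) ⊤ (volume.restrict (Icc δ T))
  caputo_integrable : ∀ t ∈ Ioo 0 T,
    IntegrableOn (fun x => caputoFront α s u x t) (Ioo 0 (s t))

end FracStefan

end

/-! Write w(ν) = Γ(1-α)⁻¹(1-ν^{2/α})^{-α} on (0,1), extended by zero. Then M₁(p,y) = ∫_y^p w(μ/p) dμ
is a Volterra kernel: continuous, vanishing for p ≤ y and locally bounded. Its iterates decay
factorially, so N is a continuous resolvent satisfying both equations N = M₁ + M₁∗N = M₁ + N∗M₁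
(`resolvent_eq_left`, `resolvent_eq_right`).

The temperature is u(x,t) = v(x t^{-α/2}) with v(z) = ∫_z^c N(c,y) dy. Fubini and the second
resolvent equation identify v with the integral of H·G_c (`integral_kernelH_mul_sourceG`). The
Dirichlet condition reads v(0) = γ; since v(0) depends continuously on c, vanishes at c = 0 and
dominates a multiple of c², some c > 0 works (`exists_integral_resolvent_eq`).

Differentiating the first resolvent equation gives v''(z) = w(z/c) + ∫ w(z/p) N(c,p) dp
(`hasDerivAt_resolvent`). Under the substitution p = xτ^{-α/2} the Caputo integral becomes t^{-α}
times the integral term (`caputoFront_eq`), while t^{-α} w(z/c) is exactly Γ(1-α)⁻¹(t -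
s⁻¹(x))^{-α}. This is the equation.

For the Stefan condition, the Beta integral gives the fractional integral of each self-similar
kernel in closed form, Γ(α)(p r^{α/2} - a)₊ (`integral_abel_kern`). Superposing these through the
first resolvent equation yields -Γ(α) r^{α/2} E(a r^{-α/2}), where E(z) = ∫_z^c (1+v)
(`memoryIntegral_eq`). As E(c) = v(c) = 0, only the constant 1 in E' = -(1+v) survives at the front,
and it produces s'(t).

The regularity claims rest on signs: a continuous function whose derivative is nonnegative inside an
interval is absolutely continuous (`absolutelyContinuousOnInterval_of_deriv_nonneg`), so the
endpoint singularities need no separate estimate. -/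

noncomputable section

namespace FracStefan

/-! ### The weight `Γ(1-α)⁻¹ (1 - ν^{2/α})^{-α}` and the first kernel -/

/-- The function `Γ(1-α)⁻¹ (1 - ν^{2/α})^{-α}` on `(0,1)`, extended by zero. -/
def weight (α : ℝ) : ℝ → ℝ :=
  (Ioo (0 : ℝ) 1).indicator fun ν => 1 / Real.Gamma (1 - α) * (1 - ν ^ (2 / α)) ^ (-α)

/-- The integral of `weight α` over `(ρ,1)`. -/
def tail (α ρ : ℝ) : ℝ := ∫ ν in ρ..1, weight α ν

/-- The kernel `M₁`, extended to a continuous function on the plane. -/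
def kern (α p y : ℝ) : ℝ := max p 0 * tail α (y / p)

variable {α : ℝ}

lemma one_div_gamma_pos (hα₁ : α < 1) : 0 < 1 / Real.Gamma (1 - α) :=
  one_div_pos.2 (Real.Gamma_pos_of_pos (by linarith))

lemma weight_of_mem {ν : ℝ} (hν : ν ∈ Ioo (0 : ℝ) 1) :
    weight α ν = 1 / Real.Gamma (1 - α) * (1 - ν ^ (2 / α)) ^ (-α) :=
  indicator_of_mem hν _

lemma weight_of_notMem {ν : ℝ} (hν : ν ∉ Ioo (0 : ℝ) 1) : weight α ν = 0 :=
  indicator_of_notMem hν _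

lemma weight_of_one_le {ν : ℝ} (hν : 1 ≤ ν) : weight α ν = 0 :=
  weight_of_notMem fun h => absurd h.2 (not_lt.2 hν)

lemma rpow_lt_one_of_mem (hα₀ : 0 < α) {ν : ℝ} (hν : ν ∈ Ioo (0 : ℝ) 1) : ν ^ (2 / α) < 1 :=
  Real.rpow_lt_one hν.1.le hν.2 (by positivity)

lemma weight_pos (hα₀ : 0 < α) (hα₁ : α < 1) {ν : ℝ} (hν : ν ∈ Ioo (0 : ℝ) 1) :
    0 < weight α ν := by
  rw [weight_of_mem hν]
  exact mul_pos (one_div_gamma_pos hα₁)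
    (Real.rpow_pos_of_pos (sub_pos.2 (rpow_lt_one_of_mem hα₀ hν)) _)

lemma weight_nonneg (hα₀ : 0 < α) (hα₁ : α < 1) (ν : ℝ) : 0 ≤ weight α ν := by
  by_cases hν : ν ∈ Ioo (0 : ℝ) 1
  · exact (weight_pos hα₀ hα₁ hν).le
  · exact (weight_of_notMem hν).ge

lemma measurable_weight : Measurable (weight α) := by
  refine Measurable.indicator ?_ measurableSet_Ioo
  fun_prop

lemma continuousAt_weight (hα₀ : 0 < α) {ν : ℝ} (hν : ν ∈ Ioo (0 : ℝ) 1) :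
    ContinuousAt (weight α) ν := by
  have h : ContinuousAt (fun ν : ℝ => 1 / Real.Gamma (1 - α) * (1 - ν ^ (2 / α)) ^ (-α)) ν := by
    refine continuousAt_const.mul (ContinuousAt.rpow_const ?_
      (Or.inl (sub_pos.2 (rpow_lt_one_of_mem hα₀ hν)).ne'))
    exact continuousAt_const.sub (continuousAt_id.rpow_const (Or.inl hν.1.ne'))
  refine h.congr ?_
  filter_upwards [Ioo_mem_nhds hν.1 hν.2] with x hx
  exact (weight_of_mem hx).symm

/-- Since 2/α ≥ 1, one has ν^{2/α} ≤ ν on (0,1). The majorant is integrable because α < 1. -/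
lemma weight_le (hα₀ : 0 < α) (hα₁ : α < 1) {ν : ℝ} (hν : ν ∈ Ioo (0 : ℝ) 1) :
    weight α ν ≤ 1 / Real.Gamma (1 - α) * (1 - ν) ^ (-α) := by
  rw [weight_of_mem hν]
  refine mul_le_mul_of_nonneg_left ?_ (one_div_gamma_pos hα₁).le
  refine Real.rpow_le_rpow_of_nonpos (sub_pos.2 hν.2) ?_ (by linarith)
  have h1 : (1 : ℝ) ≤ 2 / α := by rw [le_div_iff₀ hα₀]; linarith
  have := Real.rpow_le_rpow_of_exponent_ge hν.1 hν.2.le h1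
  rw [Real.rpow_one] at this
  linarith

lemma integrable_weight (hα₀ : 0 < α) (hα₁ : α < 1) : Integrable (weight α) := by
  have h1 : IntervalIntegrable (fun x : ℝ => (1 - x) ^ (-α)) volume 0 1 := by
    have := (intervalIntegral.intervalIntegrable_rpow' (a := 0) (b := 1) (r := -α)
      (by linarith)).comp_sub_left 1
    simpa using this.symm
  have h2 : IntegrableOn (fun x : ℝ => 1 / Real.Gamma (1 - α) * (1 - x) ^ (-α)) (Ioo 0 1) :=
    (((intervalIntegrable_iff_integrableOn_Ioc_of_le zero_le_one).1 h1).mono_set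
      Ioo_subset_Ioc_self).const_mul _
  refine (integrableOn_iff_integrable_of_support_subset (s := Ioo (0 : ℝ) 1) ?_).1 ?_
  · intro x hx
    by_contra h
    exact hx (weight_of_notMem h)
  refine Integrable.mono' h2 measurable_weight.aestronglyMeasurable ?_
  filter_upwards [ae_restrict_mem measurableSet_Ioo] with x hx
  rw [Real.norm_of_nonneg (weight_nonneg hα₀ hα₁ x)]
  exact weight_le hα₀ hα₁ hx

lemma continuous_tail (hα₀ : 0 < α) (hα₁ : α < 1) : Continuous (tail α) := by
  have h := intervalIntegral.continuous_primitive
    (fun a b => (integrable_weight hα₀ hα₁).intervalIntegrable (a := a) (b := b)) 1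
  have h2 : tail α = fun ρ => -∫ ν in (1 : ℝ)..ρ, weight α ν := by
    funext ρ; exact intervalIntegral.integral_symm _ _
  rw [h2]; exact h.neg

lemma tail_of_one_le {ρ : ℝ} (hρ : 1 ≤ ρ) : tail α ρ = 0 := by
  have : ∀ ν ∈ uIcc ρ 1, weight α ν = 0 := by
    intro ν hν
    rw [uIcc_of_ge hρ] at hν
    exact weight_of_one_le hν.1
  rw [tail, intervalIntegral.integral_congr (g := fun _ => 0) this]
  simp

lemma tail_nonneg (hα₀ : 0 < α) (hα₁ : α < 1) (ρ : ℝ) : 0 ≤ tail α ρ := by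
  rcases le_total ρ 1 with h | h
  · exact intervalIntegral.integral_nonneg h fun x _ => weight_nonneg hα₀ hα₁ x
  · exact (tail_of_one_le h).ge

lemma tail_le (hα₀ : 0 < α) (hα₁ : α < 1) (ρ : ℝ) : tail α ρ ≤ ∫ ν, weight α ν := by
  rcases le_total ρ 1 with h | h
  · rw [tail, intervalIntegral.integral_of_le h]
    exact setIntegral_le_integral (integrable_weight hα₀ hα₁)
      (Eventually.of_forall fun x => weight_nonneg hα₀ hα₁ x)
  · rw [tail_of_one_le h]
    exact integral_nonneg fun x => weight_nonneg hα₀ hα₁ x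

lemma tail_pos (hα₀ : 0 < α) (hα₁ : α < 1) {ρ : ℝ} (h0 : 0 ≤ ρ) (h1 : ρ < 1) : 0 < tail α ρ :=
  intervalIntegral.intervalIntegral_pos_of_pos_on (integrable_weight hα₀ hα₁).intervalIntegrable
    (fun _ hx => weight_pos hα₀ hα₁ ⟨h0.trans_lt hx.1, hx.2⟩) h1

lemma hasDerivAt_tail (hα₀ : 0 < α) (hα₁ : α < 1) {ρ : ℝ} (hρ : ρ ∈ Ioo (0 : ℝ) 1) :
    HasDerivAt (tail α) (-weight α ρ) ρ :=
  intervalIntegral.integral_hasDerivAt_left (integrable_weight hα₀ hα₁).intervalIntegrable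
    measurable_weight.stronglyMeasurable.stronglyMeasurableAtFilter (continuousAt_weight hα₀ hρ)

lemma kern_of_nonpos {p : ℝ} (hp : p ≤ 0) (y : ℝ) : kern α p y = 0 := by
  simp [kern, max_eq_right hp]

lemma kern_of_pos {p : ℝ} (hp : 0 < p) (y : ℝ) : kern α p y = p * tail α (y / p) := by
  simp [kern, max_eq_left hp.le]

lemma kern_of_le {p y : ℝ} (h : p ≤ y) : kern α p y = 0 := by
  rcases le_or_gt p 0 with hp | hp
  · exact kern_of_nonpos hp y
  · rw [kern_of_pos hp, tail_of_one_le ((one_le_div hp).2 h), mul_zero]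

lemma kern_nonneg (hα₀ : 0 < α) (hα₁ : α < 1) (p y : ℝ) : 0 ≤ kern α p y :=
  mul_nonneg (le_max_right _ _) (tail_nonneg hα₀ hα₁ _)

lemma kern_pos (hα₀ : 0 < α) (hα₁ : α < 1) {p y : ℝ} (hy : 0 ≤ y) (h : y < p) :
    0 < kern α p y := by
  have hp : 0 < p := hy.trans_lt h
  rw [kern_of_pos hp]
  exact mul_pos hp (tail_pos hα₀ hα₁ (by positivity) ((div_lt_one hp).2 h))

lemma kern_le (hα₀ : 0 < α) (hα₁ : α < 1) (p y : ℝ) :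
    kern α p y ≤ max p 0 * ∫ ν, weight α ν :=
  mul_le_mul_of_nonneg_left (tail_le hα₀ hα₁ _) (le_max_right _ _)

lemma continuous_kern (hα₀ : 0 < α) (hα₁ : α < 1) :
    Continuous fun q : ℝ × ℝ => kern α q.1 q.2 := by
  rw [continuous_iff_continuousAt]
  intro q
  -- At p = 0 the quotient y/p is not continuous, but `tail` is bounded, so the factor `max p 0`
  -- forces the limit 0.
  by_cases hq : q.1 = 0
  · have h0 : kern α q.1 q.2 = 0 := kern_of_nonpos hq.le _
    rw [ContinuousAt, h0]
    have hb : Tendsto (fun q : ℝ × ℝ => max q.1 0 * ∫ ν, weight α ν) (𝓝 q) (𝓝 0) := by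
      have : Continuous fun q : ℝ × ℝ => max q.1 0 * ∫ ν, weight α ν := by fun_prop
      have h := this.tendsto q
      simpa [hq] using h
    exact squeeze_zero (fun q => kern_nonneg hα₀ hα₁ _ _) (fun q => kern_le hα₀ hα₁ _ _) hb
  · have h1 : ContinuousAt (fun q : ℝ × ℝ => q.2 / q.1) q :=
      continuousAt_snd.div continuousAt_fst hq
    have h2 : ContinuousAt (fun q : ℝ × ℝ => tail α (q.2 / q.1)) q :=
      ContinuousAt.comp (f := fun q : ℝ × ℝ => q.2 / q.1)
        (continuous_tail hα₀ hα₁).continuousAt h1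
    have h3 : ContinuousAt (fun q : ℝ × ℝ => max q.1 0) q := by fun_prop
    exact h3.mul h2

lemma kern_eq_integral {p : ℝ} (hp : 0 < p) (y : ℝ) :
    kern α p y = ∫ μ in y..p, weight α (μ / p) := by
  rw [kern_of_pos hp, intervalIntegral.integral_comp_div _ hp.ne', div_self hp.ne', tail,
    smul_eq_mul]

lemma kern_eq_kernel_integral {p y : ℝ} (hy : 0 ≤ y) (h : y ≤ p) :
    1 / Real.Gamma (1 - α) * ∫ μ in y..p, (1 - p ^ (-(2 / α)) * μ ^ (2 / α)) ^ (-α) =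
      kern α p y := by
  rcases h.eq_or_lt with rfl | h
  · simp [kern_of_le]
  have hp : 0 < p := hy.trans_lt h
  rw [kern_eq_integral hp, ← intervalIntegral.integral_const_mul,
    intervalIntegral.integral_of_le h.le, intervalIntegral.integral_of_le h.le,
    integral_Ioc_eq_integral_Ioo, integral_Ioc_eq_integral_Ioo]
  refine setIntegral_congr_fun measurableSet_Ioo fun μ hμ => ?_
  have hμ0 : 0 < μ := hy.trans_lt hμ.1
  have : p ^ (-(2 / α)) * μ ^ (2 / α) = (μ / p) ^ (2 / α) := by
    rw [Real.div_rpow hμ0.le hp.le, Real.rpow_neg hp.le]; ring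
  simp only [this]
  rw [weight_of_mem ⟨by positivity, (div_lt_one hp).2 hμ.2⟩]

lemma kernelM_one_eq {p y : ℝ} (hy : 0 ≤ y) (h : y ≤ p) : kernelM α 1 p y = kern α p y := by
  rw [kernelM]
  exact kern_eq_kernel_integral hy h

lemma sourceG_eq {p y : ℝ} (hy : 0 ≤ y) (h : y ≤ p) : sourceG α p y = kern α p y :=
  kern_eq_kernel_integral hy h

/-- Used in `rpow_mul_kern` to move powers of time in and out of the kernel. -/
lemma kern_mul {l : ℝ} (hl : 0 < l) (p y : ℝ) : kern α (l * p) (l * y) = l * kern α p y := by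
  rcases le_or_gt p 0 with hp | hp
  · rw [kern_of_nonpos hp, kern_of_nonpos (by nlinarith), mul_zero]
  · rw [kern_of_pos hp, kern_of_pos (by positivity), mul_div_mul_left _ _ hl.ne', mul_assoc]

/-! ### Iterated kernels and the resolvent -/

lemma integral_eq_of_zero_left {f : ℝ → ℝ} (hf : Continuous f) {a b c : ℝ}
    (h : ∀ x ∈ uIcc a b, f x = 0) : ∫ x in a..c, f x = ∫ x in b..c, f x := by
  rw [← intervalIntegral.integral_add_adjacent_intervals (hf.intervalIntegrable a b)
    (hf.intervalIntegrable b c), intervalIntegral.integral_congr (g := fun _ => 0) h]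
  simp

lemma integral_eq_of_zero_right {f : ℝ → ℝ} (hf : Continuous f) {a b c : ℝ}
    (h : ∀ x ∈ uIcc b c, f x = 0) : ∫ x in a..c, f x = ∫ x in a..b, f x := by
  rw [← intervalIntegral.integral_add_adjacent_intervals (hf.intervalIntegrable a b)
    (hf.intervalIntegrable b c), intervalIntegral.integral_congr (g := fun _ => 0) h]
  simp

lemma integral_swap_of_continuous {F : ℝ → ℝ → ℝ} (hF : Continuous F.uncurry) (a b c d : ℝ) :
    ∫ x in a..b, ∫ y in c..d, F x y = ∫ y in c..d, ∫ x in a..b, F x y := by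
  refine intervalIntegral_intervalIntegral_swap ?_
  exact (hF.continuousOn.integrableOn_compact
    (isCompact_uIcc.prod isCompact_uIcc)).mono_set (prod_mono uIoc_subset_uIcc uIoc_subset_uIcc)

/-- The iterated kernel `M_{n+1}`, extended to a continuous function on the plane. -/
def iter (α : ℝ) : ℕ → ℝ → ℝ → ℝ
  | 0 => kern α
  | n + 1 => fun p y => ∫ a in (0 : ℝ)..p, kern α a y * iter α n p a

/-- The resolvent kernel `N`, extended to a continuous function on the plane. -/
def resolvent (α p y : ℝ) : ℝ := ∑' n : ℕ, iter α n p y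

lemma iter_zero (p y : ℝ) : iter α 0 p y = kern α p y := rfl

lemma iter_succ (n : ℕ) (p y : ℝ) :
    iter α (n + 1) p y = ∫ a in (0 : ℝ)..p, kern α a y * iter α n p a := rfl

section

variable (hα₀ : 0 < α) (hα₁ : α < 1)

include hα₀ hα₁

lemma continuous_iter (n : ℕ) : Continuous fun q : ℝ × ℝ => iter α n q.1 q.2 := by
  induction n with
  | zero => exact continuous_kern hα₀ hα₁
  | succ n ih =>
    have h1 : Continuous (Function.uncurry fun (q : ℝ × ℝ) (a : ℝ) =>
        kern α a q.2 * iter α n q.1 a) :=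
      ((continuous_kern hα₀ hα₁).comp
        (continuous_snd.prodMk (continuous_snd.comp continuous_fst))).mul
        (ih.comp ((continuous_fst.comp continuous_fst).prodMk continuous_snd))
    exact intervalIntegral.continuous_parametric_intervalIntegral_of_continuous h1 continuous_fst

lemma continuous_iter_left (n : ℕ) (y : ℝ) : Continuous fun p => iter α n p y :=
  (continuous_iter hα₀ hα₁ n).comp (continuous_id.prodMk continuous_const)

lemma continuous_iter_right (n : ℕ) (p : ℝ) : Continuous fun y => iter α n p y :=
  (continuous_iter hα₀ hα₁ n).comp (continuous_const.prodMk continuous_id)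

omit hα₀ hα₁ in
lemma iter_of_nonpos (n : ℕ) {p : ℝ} (hp : p ≤ 0) (y : ℝ) : iter α n p y = 0 := by
  cases n with
  | zero => exact kern_of_nonpos hp y
  | succ n =>
    rw [iter_succ, intervalIntegral.integral_congr (g := fun _ => 0)]
    · simp
    · intro a ha
      rw [uIcc_of_ge hp] at ha
      simp [kern_of_nonpos ha.2]

omit hα₀ hα₁ in
lemma iter_of_le (n : ℕ) {p y : ℝ} (h : p ≤ y) : iter α n p y = 0 := by
  rcases le_or_gt p 0 with hp | hp
  · exact iter_of_nonpos n hp y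
  cases n with
  | zero => exact kern_of_le h
  | succ n =>
    rw [iter_succ, intervalIntegral.integral_congr (g := fun _ => 0)]
    · simp
    · intro a ha
      rw [uIcc_of_le hp.le] at ha
      simp [kern_of_le (ha.2.trans h)]

lemma iter_nonneg (n : ℕ) (p y : ℝ) : 0 ≤ iter α n p y := by
  induction n generalizing p y with
  | zero => exact kern_nonneg hα₀ hα₁ p y
  | succ n ih =>
    rcases le_or_gt p 0 with hp | hp
    · exact (iter_of_nonpos _ hp y).ge
    · exact intervalIntegral.integral_nonneg hp.le
        fun a _ => mul_nonneg (kern_nonneg hα₀ hα₁ a y) (ih p a)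

lemma continuous_kern_mul_iter (n : ℕ) (p y : ℝ) :
    Continuous fun a => kern α a y * iter α n p a :=
  (continuous_iter_left hα₀ hα₁ 0 y).mul (continuous_iter_right hα₀ hα₁ n p)

/-- The kernel vanishes for `a ≤ y`, so the lower limit 0 in `iter` changes nothing for y ≥ 0. A
limit independent of y keeps continuity and Fubini arguments free of moving domains. -/
lemma iter_succ_eq {y : ℝ} (hy : 0 ≤ y) (n : ℕ) (p : ℝ) :
    iter α (n + 1) p y = ∫ a in y..p, kern α a y * iter α n p a := by
  refine integral_eq_of_zero_left (continuous_kern_mul_iter hα₀ hα₁ n p y) fun a ha => ?_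
  rw [uIcc_of_le hy] at ha
  rw [kern_of_le ha.2, zero_mul]

lemma iter_pos (n : ℕ) {p y : ℝ} (hy : 0 ≤ y) (h : y < p) : 0 < iter α n p y := by
  induction n generalizing p y with
  | zero => exact kern_pos hα₀ hα₁ hy h
  | succ n ih =>
    rw [iter_succ_eq hα₀ hα₁ hy]
    exact intervalIntegral.intervalIntegral_pos_of_pos_on
      ((continuous_kern_mul_iter hα₀ hα₁ n p y).intervalIntegrable _ _)
      (fun a ha => mul_pos (kern_pos hα₀ hα₁ hy ha.1) (ih (hy.trans ha.1.le) ha.2)) h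

lemma kernelM_succ_eq (n : ℕ) {p y : ℝ} (hy : 0 ≤ y) (h : y ≤ p) :
    kernelM α (n + 1) p y = iter α n p y := by
  induction n generalizing p y with
  | zero => exact kernelM_one_eq hy h
  | succ n ih =>
    rw [iter_succ_eq hα₀ hα₁ hy, kernelM]
    refine intervalIntegral.integral_congr fun a ha => ?_
    rw [uIcc_of_le h] at ha
    rw [kernelM_one_eq hy ha.1, ih (hy.trans ha.1) ha.2]

/-- Composition of kernels is associative by Fubini, so the new factor may be attached on either
side. -/
lemma iter_succ_eq_right (n : ℕ) (p y : ℝ) :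
    iter α (n + 1) p y = ∫ a in (0 : ℝ)..p, iter α n a y * kern α p a := by
  induction n generalizing p y with
  | zero => rfl
  | succ n ih =>
    rcases le_or_gt p 0 with hp | hp
    · rw [iter_of_nonpos _ hp, intervalIntegral.integral_congr (g := fun _ => 0)]
      · simp
      · intro a ha
        rw [uIcc_of_ge hp] at ha
        simp [iter_of_nonpos _ ha.2]
    have hcont : Continuous (Function.uncurry fun a b : ℝ =>
        kern α a y * (iter α n b a * kern α p b)) :=
      ((continuous_iter_left hα₀ hα₁ 0 y).comp continuous_fst).mul
        (((continuous_iter hα₀ hα₁ n).comp (continuous_snd.prodMk continuous_fst)).mul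
          ((continuous_iter_right hα₀ hα₁ 0 p).comp continuous_snd))
    rw [iter_succ]
    simp_rw [ih, ← intervalIntegral.integral_const_mul]
    rw [integral_swap_of_continuous hcont]
    refine intervalIntegral.integral_congr fun b hb => ?_
    rw [uIcc_of_le hp.le] at hb
    rw [← ih, iter_succ, ← intervalIntegral.integral_mul_const]
    simp_rw [← mul_assoc]
    -- Beyond `a = b` the factor `iter α n b a` is zero, which cuts the upper limit from `p` to `b`.
    refine integral_eq_of_zero_right
      ((continuous_kern_mul_iter hα₀ hα₁ n b y).mul continuous_const) fun a ha => ?_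
    rw [uIcc_of_le hb.2] at ha
    simp [iter_of_le n ha.1]

/-! ### Factorial bounds, convergence of the Neumann series and the resolvent equations. -/

lemma iter_le_pow (n : ℕ) {R p : ℝ} (hp : 0 ≤ p) (hpR : p ≤ R) (y : ℝ) :
    iter α n p y ≤ (R * ∫ ν, weight α ν) ^ (n + 1) * (p ^ n / n.factorial) := by
  have hB : 0 ≤ ∫ ν, weight α ν := integral_nonneg (weight_nonneg hα₀ hα₁)
  have hk : ∀ a ≤ R, ∀ z, kern α a z ≤ R * ∫ ν, weight α ν := fun a ha z =>
    (kern_le hα₀ hα₁ a z).trans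
      (mul_le_mul_of_nonneg_right (max_le ha (hp.trans hpR)) hB)
  induction n generalizing p with
  | zero => simpa [iter_zero] using hk p hpR y
  | succ n ih =>
    set D := R * ∫ ν, weight α ν
    have hD : 0 ≤ D := mul_nonneg (hp.trans hpR) hB
    -- The right recursion is essential: it integrates the bound `a ^ n / n!` in `a`, gaining the
    -- factor 1/(n+1). The left one would only see the constant `p ^ n / n!`.
    rw [iter_succ_eq_right hα₀ hα₁]
    have h1 : ∫ a in (0 : ℝ)..p, iter α n a y * kern α p a ≤
        ∫ a in (0 : ℝ)..p, D ^ (n + 1) * (a ^ n / n.factorial) * D := by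
      refine intervalIntegral.integral_mono_on hp ?_ ?_ fun a ha => ?_
      · exact ((continuous_iter_left hα₀ hα₁ n y).mul
          (continuous_iter_right hα₀ hα₁ 0 p)).intervalIntegrable _ _
      · exact Continuous.intervalIntegrable (by fun_prop) _ _
      · exact mul_le_mul (ih ha.1 (ha.2.trans hpR)) (hk p hpR a) (kern_nonneg hα₀ hα₁ _ _)
          (by have := ha.1; positivity)
    refine h1.trans_eq ?_
    rw [intervalIntegral.integral_mul_const, intervalIntegral.integral_const_mul,
      intervalIntegral.integral_div, integral_pow, Nat.factorial_succ]
    push_cast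
    have : (n.factorial : ℝ) ≠ 0 := by positivity
    have : (n : ℝ) + 1 ≠ 0 := by positivity
    simp only [ne_eq, Nat.add_eq_zero_iff, one_ne_zero, and_false, not_false_eq_true, zero_pow,
      sub_zero]
    field_simp
    ring

/-- A summable majorant of the iterated kernels on `p ≤ R`. -/
def iterBound (α R : ℝ) (n : ℕ) : ℝ :=
  (R * ∫ ν, weight α ν) ^ (n + 1) * (R ^ n / n.factorial)

omit hα₀ hα₁ in
lemma summable_iterBound (R : ℝ) : Summable (iterBound α R) := by
  have h := (Real.summable_pow_div_factorial ((R * ∫ ν, weight α ν) * R)).mul_left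
    (R * ∫ ν, weight α ν)
  refine h.congr fun n => ?_
  rw [iterBound, mul_pow, pow_succ]; ring

lemma iterBound_nonneg {R : ℝ} (hR : 0 ≤ R) (n : ℕ) : 0 ≤ iterBound α R n := by
  have hB : 0 ≤ ∫ ν, weight α ν := integral_nonneg (weight_nonneg hα₀ hα₁)
  rw [iterBound]; positivity

lemma norm_iter_le (n : ℕ) {R p : ℝ} (hR : 0 ≤ R) (hpR : p ≤ R) (y : ℝ) :
    ‖iter α n p y‖ ≤ iterBound α R n := by
  rw [Real.norm_of_nonneg (iter_nonneg hα₀ hα₁ n p y)]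
  rcases le_or_gt p 0 with hp | hp
  · rw [iter_of_nonpos n hp]; exact iterBound_nonneg hα₀ hα₁ hR n
  · refine (iter_le_pow hα₀ hα₁ n hp.le hpR y).trans ?_
    have hB : 0 ≤ ∫ ν, weight α ν := integral_nonneg (weight_nonneg hα₀ hα₁)
    rw [iterBound]
    gcongr

lemma summable_iter (p y : ℝ) : Summable fun n => iter α n p y :=
  Summable.of_norm_bounded (summable_iterBound (max p 0))
    fun n => norm_iter_le hα₀ hα₁ n (le_max_right _ _) (le_max_left _ _) y

lemma tendstoUniformlyOn_iter {R : ℝ} (hR : 0 ≤ R) :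
    TendstoUniformlyOn (fun (k : ℕ) (q : ℝ × ℝ) => ∑ n ∈ Finset.range k, iter α n q.1 q.2)
      (fun q => resolvent α q.1 q.2) atTop {q | q.1 ≤ R} :=
  tendstoUniformlyOn_tsum_nat (summable_iterBound R)
    fun n q hq => norm_iter_le hα₀ hα₁ n hR hq q.2

lemma continuous_resolvent : Continuous fun q : ℝ × ℝ => resolvent α q.1 q.2 := by
  rw [continuous_iff_continuousAt]
  intro q
  have h : ContinuousOn (fun q : ℝ × ℝ => resolvent α q.1 q.2) {r | r.1 ≤ |q.1| + 1} :=
    continuousOn_tsum (fun n => (continuous_iter hα₀ hα₁ n).continuousOn)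
      (summable_iterBound (|q.1| + 1))
      fun n r hr => norm_iter_le hα₀ hα₁ n (by positivity) hr r.2
  refine h.continuousAt ?_
  have : q.1 < |q.1| + 1 := by linarith [le_abs_self q.1]
  filter_upwards [continuous_fst.continuousAt.eventually_lt continuousAt_const this] with r hr
  exact hr.le

lemma continuous_resolvent_left (y : ℝ) : Continuous fun p => resolvent α p y :=
  (continuous_resolvent hα₀ hα₁).comp (continuous_id.prodMk continuous_const)

lemma continuous_resolvent_right (p : ℝ) : Continuous fun y => resolvent α p y :=
  (continuous_resolvent hα₀ hα₁).comp (continuous_const.prodMk continuous_id)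

lemma resolvent_nonneg (p y : ℝ) : 0 ≤ resolvent α p y :=
  tsum_nonneg fun n => iter_nonneg hα₀ hα₁ n p y

omit hα₀ hα₁ in
lemma resolvent_of_le {p y : ℝ} (h : p ≤ y) : resolvent α p y = 0 := by
  simp [resolvent, iter_of_le _ h]

lemma kern_le_resolvent (p y : ℝ) : kern α p y ≤ resolvent α p y :=
  (summable_iter hα₀ hα₁ p y).le_tsum 0 fun n _ => iter_nonneg hα₀ hα₁ n p y

lemma resolvent_pos {p y : ℝ} (hy : 0 ≤ y) (h : y < p) : 0 < resolvent α p y :=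
  (kern_pos hα₀ hα₁ hy h).trans_le (kern_le_resolvent hα₀ hα₁ p y)

lemma kernelN_eq {p y : ℝ} (hy : 0 ≤ y) (h : y ≤ p) : kernelN α p y = resolvent α p y :=
  tsum_congr fun n => kernelM_succ_eq hα₀ hα₁ n hy h

lemma norm_kern_le {R p : ℝ} (hR : 0 ≤ R) (hpR : p ≤ R) (y : ℝ) :
    ‖kern α p y‖ ≤ iterBound α R 0 := norm_iter_le hα₀ hα₁ 0 hR hpR y

/-- Summing the left recursion over n, with dominated convergence. This form has the explicit kernel
in the variable y, so it serves for differentiation in y and for the Abel integrals;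
`resolvent_eq_right` serves for the representation by H and G. -/
lemma resolvent_eq_left {p : ℝ} (hp : 0 ≤ p) (y : ℝ) :
    resolvent α p y = kern α p y + ∫ a in (0 : ℝ)..p, kern α a y * resolvent α p a := by
  have h := intervalIntegral.hasSum_integral_of_dominated_convergence (a := 0) (b := p)
    (μ := volume) (F := fun n a => kern α a y * iter α n p a)
    (f := fun a => kern α a y * resolvent α p a)
    (fun n _ => iterBound α p 0 * iterBound α p n)
    (fun n => (continuous_kern_mul_iter hα₀ hα₁ n p y).aestronglyMeasurable)
    (fun n => Eventually.of_forall fun a ha => by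
      rw [uIoc_of_le hp] at ha
      rw [norm_mul]
      exact mul_le_mul (norm_kern_le hα₀ hα₁ hp ha.2 y) (norm_iter_le hα₀ hα₁ n hp le_rfl a)
        (norm_nonneg _) (iterBound_nonneg hα₀ hα₁ hp 0))
    (Eventually.of_forall fun _ _ => (summable_iterBound p).mul_left _)
    intervalIntegrable_const
    (Eventually.of_forall fun a _ => (summable_iter hα₀ hα₁ p a).hasSum.mul_left _)
  rw [resolvent, (summable_iter hα₀ hα₁ p y).tsum_eq_zero_add, ← h.tsum_eq]
  rfl

lemma resolvent_eq_right {p : ℝ} (hp : 0 ≤ p) (y : ℝ) :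
    resolvent α p y = kern α p y + ∫ a in (0 : ℝ)..p, resolvent α a y * kern α p a := by
  have h := intervalIntegral.hasSum_integral_of_dominated_convergence (a := 0) (b := p)
    (μ := volume) (F := fun n a => iter α n a y * kern α p a)
    (f := fun a => resolvent α a y * kern α p a)
    (fun n _ => iterBound α p n * iterBound α p 0)
    (fun n => ((continuous_iter_left hα₀ hα₁ n y).mul
          (continuous_iter_right hα₀ hα₁ 0 p)).aestronglyMeasurable)
    (fun n => Eventually.of_forall fun a ha => by
      rw [uIoc_of_le hp] at ha
      rw [norm_mul]
      exact mul_le_mul (norm_iter_le hα₀ hα₁ n hp ha.2 y) (norm_kern_le hα₀ hα₁ hp le_rfl a)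
        (norm_nonneg _) (iterBound_nonneg hα₀ hα₁ hp n))
    (Eventually.of_forall fun _ _ => (summable_iterBound p).mul_right _)
    intervalIntegrable_const
    (Eventually.of_forall fun a _ => (summable_iter hα₀ hα₁ a y).hasSum.mul_right _)
  rw [resolvent, (summable_iter hα₀ hα₁ p y).tsum_eq_zero_add]
  simp_rw [iter_succ_eq_right hα₀ hα₁]
  rw [h.tsum_eq]
  rfl

/-- The uniform convergence of the series of kernels on the triangles. -/
lemma tendstoUniformlyOn_kernelM {R : ℝ} (hR : 0 < R) :
    TendstoUniformlyOn
      (fun (k : ℕ) (q : ℝ × ℝ) => ∑ n ∈ Finset.Icc 1 k, kernelM α n q.1 q.2)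
      (fun q : ℝ × ℝ => kernelN α q.1 q.2) atTop (triangle R) := by
  have h := (tendstoUniformlyOn_iter hα₀ hα₁ hR.le).mono
    (show triangle R ⊆ {q | q.1 ≤ R} from fun q hq => hq.2.2)
  refine (h.congr ?_).congr_right ?_
  · filter_upwards with k q hq
    simp only
    -- The kernels are numbered from 1 and `iter` from 0, so the sum over 1, …, k becomes a sum over
    -- `range k`.
    rw [← Finset.Ico_add_one_right_eq_Icc, Finset.sum_Ico_eq_sum_range, Nat.add_sub_cancel]
    refine Finset.sum_congr rfl fun n _ => ?_
    rw [add_comm, kernelM_succ_eq hα₀ hα₁ n hq.1 hq.2.1]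
  · intro q hq
    exact (kernelN_eq hα₀ hα₁ hq.1 hq.2.1).symm

/-- The total mass of the resolvent takes every positive value. -/
lemma exists_integral_resolvent_eq {γ : ℝ} (hγ : 0 < γ) :
    ∃ c : ℝ, 0 < c ∧ ∫ y in (0 : ℝ)..c, resolvent α c y = γ := by
  set m := ∫ z in (0 : ℝ)..1, tail α z
  have hm : 0 < m := intervalIntegral.intervalIntegral_pos_of_pos_on
    ((continuous_tail hα₀ hα₁).intervalIntegrable _ _)
    (fun z hz => tail_pos hα₀ hα₁ hz.1.le hz.2) one_pos
  have hcont : Continuous fun c : ℝ => ∫ y in (0 : ℝ)..c, resolvent α c y :=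
    intervalIntegral.continuous_parametric_intervalIntegral_of_continuous
      (continuous_resolvent hα₀ hα₁) continuous_id
  -- By scaling, M₁(c',·) has mass c'² m on (0,c'), and this choice makes it equal to γ. The
  -- resolvent dominates M₁.
  set c' := Real.sqrt (γ / m)
  have hc' : 0 < c' := Real.sqrt_pos.2 (by positivity)
  have hge : γ ≤ ∫ y in (0 : ℝ)..c', resolvent α c' y := by
    have h1 : ∫ y in (0 : ℝ)..c', kern α c' y = γ := by
      simp_rw [kern_of_pos hc']
      rw [intervalIntegral.integral_const_mul, intervalIntegral.integral_comp_div _ hc'.ne',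
        zero_div, div_self hc'.ne', smul_eq_mul, ← mul_assoc, Real.mul_self_sqrt (by positivity)]
      exact div_mul_cancel₀ _ hm.ne'
    rw [← h1]
    exact intervalIntegral.integral_mono_on hc'.le
      ((continuous_iter_right hα₀ hα₁ 0 c').intervalIntegrable _ _)
      ((continuous_resolvent_right hα₀ hα₁ c').intervalIntegrable _ _)
      fun y _ => kern_le_resolvent hα₀ hα₁ c' y
  obtain ⟨c, hc, hcγ⟩ := intermediate_value_Icc hc'.le hcont.continuousOn
    (show γ ∈ Icc _ _ from ⟨by simpa using hγ.le, hge⟩)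
  -- At c = 0 the integral is zero and cannot equal γ.
  refine ⟨c, lt_of_le_of_ne hc.1 fun h => ?_, hcγ⟩
  rw [← h] at hcγ
  simp at hcγ
  exact hγ.ne hcγ

end

/-! ### The temperature profile -/

/-- The profile `v(x) = ∫_x^c N(c,y) dy` of the self-similar temperature. -/
def profile (α c x : ℝ) : ℝ := ∫ y in x..c, resolvent α c y

/-- The nonlocal part `∫ Γ(1-α)⁻¹ (1 - (z/p)^{2/α})^{-α} N(c,p) dp` of the second derivative of
the profile. -/
def memoryTerm (α c z : ℝ) : ℝ := ∫ p in (0 : ℝ)..c, weight α (z / p) * resolvent α c p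

/-- Tonelli: for a nonnegative integrand, known inner integrals with an integrable outcome give
joint integrability. This justifies the Fubini swaps with singular integrands. -/
lemma integrableOn_prod_of_nonneg {F : ℝ → ℝ → ℝ} {S T : Set ℝ} {g : ℝ → ℝ}
    (hS : MeasurableSet S) (hT : MeasurableSet T) (hF : Measurable F.uncurry)
    (h0 : ∀ x ∈ S, ∀ y ∈ T, 0 ≤ F x y) (hy : ∀ x ∈ S, IntegrableOn (F x) T)
    (hg : IntegrableOn g S) (h : ∀ x ∈ S, ∫ y in T, F x y = g x) :
    IntegrableOn F.uncurry (S ×ˢ T) := by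
  rw [IntegrableOn, Measure.volume_eq_prod, ← Measure.prod_restrict,
    integrable_prod_iff hF.aestronglyMeasurable]
  constructor
  · filter_upwards [ae_restrict_mem hS] with x hx using hy x hx
  · refine hg.congr ?_
    filter_upwards [ae_restrict_mem hS] with x hx
    rw [← h x hx]
    refine setIntegral_congr_fun hT fun y hy => ?_
    exact (Real.norm_of_nonneg (h0 x hx y hy)).symm

section

variable (hα₀ : 0 < α) (hα₁ : α < 1)

include hα₀ hα₁

/-- The extended resolvent is continuous on the whole line and zero beyond c. The profile is
therefore C¹ across c, and one-sided derivatives at the front come from two-sided ones. -/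
lemma hasDerivAt_profile (c x : ℝ) : HasDerivAt (profile α c) (-resolvent α c x) x :=
  intervalIntegral.integral_hasDerivAt_left
    ((continuous_resolvent_right hα₀ hα₁ c).intervalIntegrable _ _)
    (continuous_resolvent_right hα₀ hα₁ c).stronglyMeasurable.stronglyMeasurableAtFilter
    (continuous_resolvent_right hα₀ hα₁ c).continuousAt

lemma continuous_profile (c : ℝ) : Continuous (profile α c) :=
  continuous_iff_continuousAt.2 fun x => (hasDerivAt_profile hα₀ hα₁ c x).continuousAt

omit hα₀ hα₁ in
lemma profile_self (c : ℝ) : profile α c c = 0 := intervalIntegral.integral_same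

lemma profile_pos {c x : ℝ} (hx : 0 ≤ x) (h : x < c) : 0 < profile α c x :=
  intervalIntegral.intervalIntegral_pos_of_pos_on
    ((continuous_resolvent_right hα₀ hα₁ c).intervalIntegrable _ _)
    (fun _ hy => resolvent_pos hα₀ hα₁ (hx.trans hy.1.le) hy.2) h

/-! ### The integral representation by H and G. -/

lemma kernelH_eq {p z : ℝ} (hz : 0 ≤ z) (h : z ≤ p) :
    kernelH α p z = 1 + ∫ y in z..p, resolvent α p y := by
  rw [kernelH]
  congr 1
  refine intervalIntegral.integral_congr fun y hy => ?_
  rw [uIcc_of_le h] at hy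
  exact kernelN_eq hα₀ hα₁ (hz.trans hy.1) hy.2

lemma continuous_integral_resolvent (z : ℝ) :
    Continuous fun p => ∫ y in z..p, resolvent α p y :=
  intervalIntegral.continuous_parametric_intervalIntegral_of_continuous
    (continuous_resolvent hα₀ hα₁) continuous_id

lemma kernelH_mul_sourceG_eqOn {c z : ℝ} (hz : 0 ≤ z) (h : z ≤ c) :
    EqOn (fun p => (1 + ∫ y in z..p, resolvent α p y) * kern α c p)
      (fun p => kernelH α p z * sourceG α c p) (uIcc z c) := by
  intro p hp
  rw [uIcc_of_le h] at hp
  simp only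
  rw [kernelH_eq hα₀ hα₁ hz hp.1, sourceG_eq (hz.trans hp.1) hp.2]

lemma intervalIntegrable_kernelH_mul_sourceG {c z : ℝ} (hz : 0 ≤ z) (h : z ≤ c) :
    IntervalIntegrable (fun p => kernelH α p z * sourceG α c p) volume z c := by
  refine ContinuousOn.intervalIntegrable
    (ContinuousOn.congr ?_ (kernelH_mul_sourceG_eqOn hα₀ hα₁ hz h).symm)
  exact ((continuous_const.add (continuous_integral_resolvent hα₀ hα₁ z)).mul
    (continuous_iter_right hα₀ hα₁ 0 c)).continuousOn

/-- Expanding H and exchanging the integrals over z ≤ y ≤ p ≤ c leaves, under the integral in y, the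
right-hand side of `resolvent_eq_right`. -/
lemma integral_kernelH_mul_sourceG {c z : ℝ} (hz : 0 ≤ z) (h : z ≤ c) :
    ∫ p in z..c, kernelH α p z * sourceG α c p = profile α c z := by
  have hk : Continuous fun y => kern α c y := continuous_iter_right hα₀ hα₁ 0 c
  have hkm : Continuous fun p => (∫ y in z..p, resolvent α p y) * kern α c p :=
    (continuous_integral_resolvent hα₀ hα₁ z).mul hk
  rw [← intervalIntegral.integral_congr (kernelH_mul_sourceG_eqOn hα₀ hα₁ hz h)]
  simp_rw [add_mul, one_mul]
  rw [intervalIntegral.integral_add (hk.intervalIntegrable _ _)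
    (hkm.intervalIntegrable _ _)]
  have h1 : ∫ p in z..c, (∫ y in z..p, resolvent α p y) * kern α c p =
      ∫ p in z..c, ∫ y in z..c, resolvent α p y * kern α c p := by
    refine intervalIntegral.integral_congr fun p hp => ?_
    rw [uIcc_of_le h] at hp
    rw [intervalIntegral.integral_mul_const, integral_eq_of_zero_right (b := p) (c := c)
      (continuous_resolvent_right hα₀ hα₁ p)]
    intro y hy
    rw [uIcc_of_le hp.2] at hy
    exact resolvent_of_le hy.1
  have hF : Continuous (Function.uncurry fun p y : ℝ => resolvent α p y * kern α c p) :=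
    (continuous_resolvent hα₀ hα₁).mul (hk.comp continuous_fst)
  rw [h1, integral_swap_of_continuous hF]
  rw [← intervalIntegral.integral_add (hk.intervalIntegrable _ _)]
  · refine intervalIntegral.integral_congr fun y hy => ?_
    rw [uIcc_of_le h] at hy
    rw [resolvent_eq_right hα₀ hα₁ (hz.trans h)]
    congr 1
    refine (integral_eq_of_zero_left
      ((continuous_resolvent_left hα₀ hα₁ y).mul hk) fun p hp => ?_).symm
    rw [uIcc_of_le hz] at hp
    change resolvent α p y * _ = 0
    rw [resolvent_of_le (hp.2.trans hy.1), zero_mul]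
  · exact (intervalIntegral.continuous_parametric_intervalIntegral_of_continuous'
      (f := fun y p => resolvent α p y * kern α c p)
      (hF.comp continuous_swap) _ _).intervalIntegrable _ _

lemma resolvent_le (c y : ℝ) : resolvent α c y ≤ ∑' n, iterBound α (max c 0) n :=
  (summable_iter hα₀ hα₁ c y).tsum_le_tsum
    (fun n => (le_abs_self _).trans
      (norm_iter_le hα₀ hα₁ n (le_max_right _ _) (le_max_left _ _) y)) (summable_iterBound _)

/-! ### The second derivative of the profile -/

lemma integrable_weight_div {p : ℝ} (hp : p ≠ 0) : Integrable fun μ => weight α (μ / p) :=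
  (integrable_weight hα₀ hα₁).comp_div hp

lemma kern_eq_integral_of_le {p c : ℝ} (hp : 0 < p) (h : p ≤ c) (z : ℝ) :
    ∫ μ in z..c, weight α (μ / p) = kern α p z := by
  have hi := integrable_weight_div hα₀ hα₁ hp.ne'
  rw [kern_eq_integral hp, ← intervalIntegral.integral_add_adjacent_intervals
    (hi.intervalIntegrable (a := z) (b := p)) (hi.intervalIntegrable (a := p) (b := c)),
    intervalIntegral.integral_congr (a := p) (b := c) (g := fun _ => 0)]
  · simp
  · intro μ hμ
    rw [uIcc_of_le h] at hμ
    exact weight_of_one_le ((one_le_div hp).2 hμ.1)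

/-- Writing the kernel as an integral of the weight over μ and exchanging integrals exhibits the
convolution as a primitive in z. -/
lemma integral_kern_mul_resolvent {c z : ℝ} (hc : 0 ≤ c) (h : z ≤ c) :
    ∫ p in (0 : ℝ)..c, kern α p z * resolvent α c p = ∫ μ in z..c, memoryTerm α c μ := by
  have hr := continuous_resolvent_right hα₀ hα₁ c
  have hcont : Continuous fun p => kern α p z * resolvent α c p :=
    (continuous_iter_left hα₀ hα₁ 0 z).mul hr
  have h1 : ∀ p ∈ Ioc 0 c, ∫ μ in z..c, weight α (μ / p) * resolvent α c p =
      kern α p z * resolvent α c p := fun p hp => by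
    rw [intervalIntegral.integral_mul_const, kern_eq_integral_of_le hα₀ hα₁ hp.1 hp.2]
  have h2 : ∫ p in (0 : ℝ)..c, kern α p z * resolvent α c p =
      ∫ p in (0 : ℝ)..c, ∫ μ in z..c, weight α (μ / p) * resolvent α c p := by
    rw [intervalIntegral.integral_of_le hc, intervalIntegral.integral_of_le hc]
    exact setIntegral_congr_fun measurableSet_Ioc fun p hp => (h1 p hp).symm
  rw [h2, intervalIntegral_intervalIntegral_swap]
  · rfl
  rw [uIoc_of_le hc, uIoc_of_le h]
  refine integrableOn_prod_of_nonneg (g := fun p => kern α p z * resolvent α c p)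
    measurableSet_Ioc measurableSet_Ioc ?_ ?_ ?_ ?_ ?_
  · exact (measurable_weight.comp (measurable_snd.div measurable_fst)).mul
      (hr.measurable.comp measurable_fst)
  · exact fun p _ μ _ => mul_nonneg (weight_nonneg hα₀ hα₁ _) (resolvent_nonneg hα₀ hα₁ _ _)
  · exact fun p hp => ((integrable_weight_div hα₀ hα₁ hp.1.ne').mul_const _).integrableOn
  · exact (intervalIntegrable_iff_integrableOn_Ioc_of_le hc).1 (hcont.intervalIntegrable _ _)
  · intro p hp
    rw [← h1 p hp, intervalIntegral.integral_of_le h]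

lemma weight_inv_le {L σ : ℝ} (h1 : 1 < σ) (hL : σ ≤ L) :
    weight α (1 / σ) ≤ 1 / Real.Gamma (1 - α) * (L ^ α * (σ - 1) ^ (-α)) := by
  have hσ : 0 < σ := one_pos.trans h1
  have hσ1 : 0 < σ - 1 := sub_pos.2 h1
  refine (weight_le hα₀ hα₁ ⟨by positivity, (div_lt_one hσ).2 h1⟩).trans ?_
  refine mul_le_mul_of_nonneg_left ?_ (one_div_gamma_pos hα₁).le
  have : (1 - 1 / σ) = (σ - 1) / σ := by field_simp
  rw [this, Real.div_rpow hσ1.le hσ.le, Real.rpow_neg hσ.le, div_inv_eq_mul, mul_comm]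
  gcongr

/-- The integrand vanishes for σ ≤ 1; its only singularity is of order (σ-1)^{-α}, to the right of
1. -/
lemma intervalIntegrable_weight_inv {L : ℝ} (hL : 0 ≤ L) :
    IntervalIntegrable (fun σ => weight α (1 / σ)) volume 0 L := by
  rw [intervalIntegrable_iff_integrableOn_Ioc_of_le hL]
  have hb : IntegrableOn (fun σ => 1 / Real.Gamma (1 - α) * (L ^ α * (σ - 1) ^ (-α)))
      (Ioc 1 L) := by
    rcases le_total L 1 with h | h
    · rw [Ioc_eq_empty (not_lt.2 h)]; exact integrableOn_empty
    refine (Integrable.const_mul ?_ _).const_mul _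
    have := (intervalIntegral.intervalIntegrable_rpow' (a := 0) (b := L - 1) (r := -α)
      (by linarith)).comp_sub_right 1
    simp only [zero_add, sub_add_cancel] at this
    exact (intervalIntegrable_iff_integrableOn_Ioc_of_le h).1 this
  have hm : Measurable fun σ => weight α (1 / σ) :=
    measurable_weight.comp (measurable_const.div measurable_id)
  have h1 : IntegrableOn (fun σ => weight α (1 / σ)) (Ioc 1 L) := by
    refine Integrable.mono' hb hm.aestronglyMeasurable ?_
    filter_upwards [ae_restrict_mem measurableSet_Ioc] with σ hσ
    rw [Real.norm_of_nonneg (weight_nonneg hα₀ hα₁ _)]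
    exact weight_inv_le hα₀ hα₁ hσ.1 hσ.2
  have h2 : IntegrableOn (fun σ => weight α (1 / σ)) (Ioc 0 1) := by
    refine (integrableOn_zero (ε' := ℝ)).congr_fun (fun σ hσ => ?_) measurableSet_Ioc
    exact (weight_of_one_le ((one_le_div hσ.1).2 hσ.2)).symm
  refine (h2.union h1).mono_set fun σ hσ => ?_
  rcases le_or_gt σ 1 with h | h
  · exact Or.inl ⟨hσ.1, h⟩
  · exact Or.inr ⟨h, hσ.2⟩

-- Putting p = zσ moves z out of the singular weight and into the continuous factor, so that
-- dominated convergence applies. Any L ≥ c/z is allowed because the resolvent vanishes beyond c.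
omit hα₀ hα₁ in
lemma memoryTerm_eq_mul {c z L : ℝ} (hc : 0 ≤ c) (hz : 0 < z) (hL : c / z ≤ L) :
    memoryTerm α c z = z * ∫ σ in (0 : ℝ)..L, weight α (1 / σ) * resolvent α c (z * σ) := by
  have h1 : ∀ σ, weight α (1 / σ) * resolvent α c (z * σ) =
      weight α (z / (z * σ)) * resolvent α c (z * σ) := by
    intro σ
    rw [div_mul_eq_div_div, div_self hz.ne']
  simp_rw [h1]
  have hcz : c ≤ z * L := by rw [mul_comm]; exact (div_le_iff₀ hz).1 hL
  rw [intervalIntegral.integral_comp_mul_left (fun p => weight α (z / p) * resolvent α c p) hz.ne',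
    smul_eq_mul, mul_inv_cancel_left₀ hz.ne', mul_zero, memoryTerm,
    intervalIntegral.integral_of_le hc, intervalIntegral.integral_of_le (hc.trans hcz)]
  refine (setIntegral_eq_of_subset_of_forall_sdiff_eq_zero measurableSet_Ioc
    (Ioc_subset_Ioc_right hcz) fun p hp => ?_).symm
  rw [resolvent_of_le, mul_zero]
  by_contra h
  exact hp.2 ⟨hp.1.1, (not_le.1 h).le⟩

lemma continuousAt_memoryTerm {c z : ℝ} (hc : 0 < c) (hz : 0 < z) :
    ContinuousAt (memoryTerm α c) z := by
  have hz2 : 0 < z / 2 := by positivity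
  -- One upper limit valid for all x > z/2.
  set L := c / (z / 2)
  have hL : 0 < L := by positivity
  have hr := continuous_resolvent_right hα₀ hα₁ c
  have hm : Measurable fun σ => weight α (1 / σ) :=
    measurable_weight.comp (measurable_const.div measurable_id)
  have h1 : ContinuousAt
      (fun x => ∫ σ in (0 : ℝ)..L, weight α (1 / σ) * resolvent α c (x * σ)) z := by
    refine intervalIntegral.continuousAt_of_dominated_interval
      (bound := fun σ => weight α (1 / σ) * ∑' n, iterBound α (max c 0) n) ?_ ?_ ?_ ?_
    · filter_upwards with x
      exact (hm.mul (hr.comp (continuous_const.mul continuous_id)).measurable).aestronglyMeasurable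
    · filter_upwards with x
      refine Eventually.of_forall fun σ _ => ?_
      rw [Real.norm_of_nonneg (mul_nonneg (weight_nonneg hα₀ hα₁ _) (resolvent_nonneg hα₀ hα₁ _ _))]
      exact mul_le_mul_of_nonneg_left (resolvent_le hα₀ hα₁ _ _) (weight_nonneg hα₀ hα₁ _)
    · exact (intervalIntegrable_weight_inv hα₀ hα₁ hL.le).mul_const _
    · refine Eventually.of_forall fun σ _ => ?_
      exact (continuous_const.mul (hr.comp (continuous_id.mul continuous_const))).continuousAt
  refine (continuousAt_id.mul h1).congr ?_
  filter_upwards [Ioi_mem_nhds (half_lt_self hz)] with x hx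
  have hx0 : 0 < x := hz2.trans hx
  refine (memoryTerm_eq_mul hc.le hx0 ?_).symm
  exact div_le_div_of_nonneg_left hc.le hz2 (le_of_lt hx)

lemma memoryTerm_nonneg {c : ℝ} (hc : 0 ≤ c) (z : ℝ) : 0 ≤ memoryTerm α c z :=
  intervalIntegral.integral_nonneg hc
    fun _ _ => mul_nonneg (weight_nonneg hα₀ hα₁ _) (resolvent_nonneg hα₀ hα₁ _ _)

lemma resolvent_eq_add_integral {c z : ℝ} (hc : 0 ≤ c) (h : z ≤ c) :
    resolvent α c z = kern α c z + ∫ μ in z..c, memoryTerm α c μ := by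
  rw [resolvent_eq_left hα₀ hα₁ hc, integral_kern_mul_resolvent hα₀ hα₁ hc h]

/-- `resolvent_eq_add_integral` presents the resolvent as a sum of two primitives, whose integrands
are continuous inside (0,c). -/
lemma hasDerivAt_resolvent {c z : ℝ} (hz : z ∈ Ioo 0 c) :
    HasDerivAt (resolvent α c) (-(weight α (z / c) + memoryTerm α c z)) z := by
  have hc : 0 < c := hz.1.trans hz.2
  have h1 : HasDerivAt (kern α c) (-weight α (z / c)) z := by
    have h := ((hasDerivAt_tail hα₀ hα₁ (ρ := z / c)
      ⟨div_pos hz.1 hc, (div_lt_one hc).2 hz.2⟩).comp z ((hasDerivAt_id z).div_const c)).const_mul c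
    have he : kern α c = fun y => c * (tail α ∘ fun y => y / c) y :=
      funext fun y => kern_of_pos hc y
    rw [he]
    refine h.congr_deriv ?_
    rw [one_div, mul_comm (-_), mul_inv_cancel_left₀ hc.ne']
  have hJ : ContinuousOn (memoryTerm α c) (Ioi 0) := fun x hx =>
    (continuousAt_memoryTerm hα₀ hα₁ hc hx).continuousWithinAt
  have h2 : HasDerivAt (fun z => ∫ μ in z..c, memoryTerm α c μ) (-memoryTerm α c z) z := by
    refine intervalIntegral.integral_hasDerivAt_left ?_ ?_
      (continuousAt_memoryTerm hα₀ hα₁ hc hz.1)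
    · refine (hJ.mono fun x hx => ?_).intervalIntegrable
      rw [uIcc_of_le hz.2.le] at hx
      exact hz.1.trans_le hx.1
    · exact hJ.stronglyMeasurableAtFilter isOpen_Ioi z hz.1
  have h3 := h1.add h2
  rw [← neg_add] at h3
  refine h3.congr_of_eventuallyEq ?_
  filter_upwards [Iio_mem_nhds hz.2] with x hx
  exact resolvent_eq_add_integral hα₀ hα₁ hc.le (le_of_lt hx)

end

/-! ### Absolute continuity and weak derivatives -/

lemma absolutelyContinuousOnInterval_congr {f g : ℝ → ℝ} {a b : ℝ}
    (hf : AbsolutelyContinuousOnInterval f a b) (h : EqOn f g (uIcc a b)) :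
    AbsolutelyContinuousOnInterval g a b := by
  rw [absolutelyContinuousOnInterval_iff] at hf ⊢
  intro ε hε
  obtain ⟨δ, hδ, H⟩ := hf ε hε
  refine ⟨δ, hδ, fun E hE hlt => ?_⟩
  refine (Finset.sum_congr rfl fun i hi => ?_).trans_lt (H E hE hlt)
  rw [h (hE.1 i hi).1, h (hE.1 i hi).2]

/-- Monotonicity makes `f'` integrable with no bound near the endpoints; `f` is then the indefinite
integral of its derivative. -/
lemma absolutelyContinuousOnInterval_of_deriv_nonneg {f f' : ℝ → ℝ} {a b : ℝ} (hab : a ≤ b)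
    (hf : ContinuousOn f (Icc a b)) (hd : ∀ x ∈ Ioo a b, HasDerivAt f (f' x) x)
    (h0 : ∀ x ∈ Ioo a b, 0 ≤ f' x) :
    IntervalIntegrable f' volume a b ∧ AbsolutelyContinuousOnInterval f a b := by
  have hi : IntervalIntegrable f' volume a b :=
    intervalIntegral.intervalIntegrable_deriv_of_nonneg (by rwa [uIcc_of_le hab])
      (by rwa [min_eq_left hab, max_eq_right hab]) (by rwa [min_eq_left hab, max_eq_right hab])
  refine ⟨hi, ?_⟩
  have hac := hi.absolutelyContinuousOnInterval_intervalIntegral (c := a) left_mem_uIcc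
  have hc : AbsolutelyContinuousOnInterval (fun _ : ℝ => f a) a b :=
    contDiffOn_const.absolutelyContinuousOnInterval
  refine absolutelyContinuousOnInterval_congr (hc.add hac) fun x hx => ?_
  rw [uIcc_of_le hab] at hx
  have hsub : uIcc a x ⊆ uIcc a b := by
    rw [uIcc_of_le hx.1, uIcc_of_le hab]; exact Icc_subset_Icc_right hx.2
  have := intervalIntegral.integral_eq_sub_of_hasDerivAt_of_le hx.1
    (hf.mono (Icc_subset_Icc_right hx.2)) (fun y hy => hd y ⟨hy.1, hy.2.trans_le hx.2⟩)
    (hi.mono_set hsub)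
  simp [this]

lemma isWeakDeriv_of_absolutelyContinuous {f f' : ℝ → ℝ} {a b : ℝ} (hab : a ≤ b)
    (hf : AbsolutelyContinuousOnInterval f a b) (hd : ∀ x ∈ Ioo a b, HasDerivAt f (f' x) x) :
    IsWeakDeriv a b f f' := by
  intro φ hφ _ hsupp
  have hφ0 : ∀ x ∉ Ioo a b, φ x = 0 := fun x hx =>
    image_eq_zero_of_notMem_tsupport fun h => hx (hsupp h)
  have hφac : AbsolutelyContinuousOnInterval φ a b :=
    ((hφ.of_le (by simp)).contDiffOn (n := 1)).absolutelyContinuousOnInterval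
  have h := hf.integral_mul_deriv_eq_deriv_mul hφac
  rw [hφ0 a (by simp), hφ0 b (by simp), intervalIntegral.integral_of_le hab,
    intervalIntegral.integral_of_le hab, integral_Ioc_eq_integral_Ioo,
    integral_Ioc_eq_integral_Ioo] at h
  rw [h, mul_zero, mul_zero, sub_zero, zero_sub]
  congr 1
  exact setIntegral_congr_fun measurableSet_Ioo fun x hx => by rw [(hd x hx).deriv]

/-! ### A Beta integral -/

/-- This is B(1-α, α). The parameters add up to 1, so the length of the interval enters with power 0
and the denominator is Γ(1) = 1. -/
lemma integral_rpow_mul_rpow (hα₀ : 0 < α) (hα₁ : α < 1) {β r : ℝ} (h : β < r) :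
    ∫ τ in β..r, (r - τ) ^ (α - 1) * (τ - β) ^ (-α) =
      Real.Gamma α * Real.Gamma (1 - α) := by
  have h1 : ∫ τ in β..r, (r - τ) ^ (α - 1) * (τ - β) ^ (-α) =
      ∫ x in (0 : ℝ)..(r - β), x ^ (-α) * (r - β - x) ^ (α - 1) := by
    have h0 := intervalIntegral.integral_comp_sub_right (a := β) (b := r)
      (fun x => x ^ (-α) * (r - β - x) ^ (α - 1)) β
    rw [sub_self] at h0
    rw [← h0]
    refine intervalIntegral.integral_congr fun τ _ => ?_
    rw [mul_comm]; congr 2; ring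
  rw [h1]
  have hr : 0 < r - β := sub_pos.2 h
  have h2 := Complex.betaIntegral_scaled ((1 - α : ℝ) : ℂ) (α : ℂ) hr
  have h3 := Complex.Gamma_mul_Gamma_eq_betaIntegral (s := ((1 - α : ℝ) : ℂ)) (t := (α : ℂ))
    (by rw [Complex.ofReal_re]; linarith) (by rw [Complex.ofReal_re]; exact hα₀)
  have h4 : ((1 - α : ℝ) : ℂ) + (α : ℂ) = 1 := by push_cast; ring
  rw [h4, Complex.Gamma_one, one_mul] at h3
  rw [h4, sub_self, Complex.cpow_zero, one_mul, ← h3, Complex.Gamma_ofReal,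
    Complex.Gamma_ofReal] at h2
  have h5 : ((∫ x in (0 : ℝ)..(r - β), x ^ (-α) * (r - β - x) ^ (α - 1) : ℝ) : ℂ) =
      ((Real.Gamma (1 - α) * Real.Gamma α : ℝ) : ℂ) := by
    rw [← intervalIntegral.integral_ofReal, Complex.ofReal_mul, ← h2]
    refine intervalIntegral.integral_congr fun x hx => ?_
    rw [uIcc_of_le hr.le] at hx
    rw [Complex.ofReal_mul, Complex.ofReal_cpow hx.1, Complex.ofReal_cpow (sub_nonneg.2 hx.2)]
    push_cast
    congr 2
    ring
  rw [mul_comm (Real.Gamma α)]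
  exact_mod_cast h5

lemma intervalIntegrable_rpow_mul_rpow (hα₀ : 0 < α) (hα₁ : α < 1) {β r : ℝ} (h : β < r) :
    IntervalIntegrable (fun τ => (r - τ) ^ (α - 1) * (τ - β) ^ (-α)) volume β r := by
  -- A non-integrable function has integral 0 by convention, whereas the Beta value is positive.
  by_contra hn
  have := integral_rpow_mul_rpow hα₀ hα₁ h
  rw [intervalIntegral.integral_undef hn] at this
  exact (mul_pos (Real.Gamma_pos_of_pos hα₀)
    (Real.Gamma_pos_of_pos (show 0 < 1 - α by linarith))).ne this

lemma intervalIntegrable_sub_rpow {κ : ℝ} (hκ : -1 < κ) (b r : ℝ) :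
    IntervalIntegrable (fun τ => (r - τ) ^ κ) volume b r := by
  have := (intervalIntegral.intervalIntegrable_rpow' (a := r - b) (b := 0) hκ).comp_sub_left r
  simpa using this

section

variable (hα₀ : 0 < α) (hα₁ : α < 1)

include hα₀

/-! ### The Abel transform of the self-similar first kernel. -/

lemma half_mul_two_div : α / 2 * (2 / α) = 1 := by
  field_simp

lemma rpow_lt_iff_lt_mul_rpow {x p r : ℝ} (hx : 0 ≤ x) (hp : 0 < p) (hr : 0 ≤ r) :
    (x / p) ^ (2 / α) < r ↔ x < p * r ^ (α / 2) := by
  have h1 : r = (r ^ (α / 2)) ^ (2 / α) := by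
    rw [← Real.rpow_mul hr, half_mul_two_div hα₀, Real.rpow_one]
  conv_lhs => rw [h1]
  rw [Real.rpow_lt_rpow_iff (by positivity) (by positivity) (by positivity), div_lt_iff₀' hp]

/-- In the time variable the weight is an Abel kernel that starts at β = (x/p)^{2/α}, the time when
the curve pτ^{α/2} reaches x. -/
lemma rpow_neg_mul_weight {x p τ : ℝ} (hx : 0 < x) (hp : 0 < p) (hτ : 0 < τ) :
    τ ^ (-α) * weight α (x / (p * τ ^ (α / 2))) =
      (Ioi ((x / p) ^ (2 / α))).indicator
        (fun τ => 1 / Real.Gamma (1 - α) * (τ - (x / p) ^ (2 / α)) ^ (-α)) τ := by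
  by_cases h : (x / p) ^ (2 / α) < τ
  · have h' := (rpow_lt_iff_lt_mul_rpow hα₀ hx.le hp hτ.le).1 h
    rw [indicator_of_mem (mem_Ioi.2 h),
      weight_of_mem ⟨by positivity, (div_lt_one (by positivity)).2 h'⟩]
    have h1 : (x / (p * τ ^ (α / 2))) ^ (2 / α) = (x / p) ^ (2 / α) / τ := by
      rw [← div_div, Real.div_rpow (by positivity) (by positivity), ← Real.rpow_mul hτ.le,
        half_mul_two_div hα₀, Real.rpow_one]
    have h2 : 1 - (x / p) ^ (2 / α) / τ = (τ - (x / p) ^ (2 / α)) / τ := by field_simp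
    rw [h1, h2, Real.div_rpow (sub_nonneg.2 h.le) hτ.le]
    have : τ ^ (-α) ≠ 0 := (Real.rpow_pos_of_pos hτ _).ne'
    field_simp
  · have h' := not_lt.1 (mt (rpow_lt_iff_lt_mul_rpow hα₀ hx.le hp hτ.le).2 h)
    rw [indicator_of_notMem (by simpa using h), weight_of_one_le, mul_zero]
    exact (one_le_div (by positivity)).2 h'

include hα₁

lemma rpow_mul_kern {p q a τ : ℝ} (hp : 0 < p) (hτ : 0 < τ) (hq : p * τ ^ (α / 2) ≤ q) :
    τ ^ (-(α / 2)) * kern α p (a * τ ^ (-(α / 2))) =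
      ∫ x in a..q, τ ^ (-α) * weight α (x / (p * τ ^ (α / 2))) := by
  have hl : 0 < τ ^ (α / 2) := Real.rpow_pos_of_pos hτ _
  rw [intervalIntegral.integral_const_mul, kern_eq_integral_of_le hα₀ hα₁ (by positivity) hq]
  have h1 : a = τ ^ (α / 2) * (a * τ ^ (-(α / 2))) := by
    rw [Real.rpow_neg hτ.le]; field_simp
  have h2 : τ ^ (-α) = (τ ^ (α / 2))⁻¹ * (τ ^ (α / 2))⁻¹ := by
    rw [← Real.rpow_neg hτ.le, ← Real.rpow_add hτ]; congr 1; ring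
  conv_rhs => rw [h1, mul_comm p, kern_mul hl, h2]
  rw [Real.rpow_neg hτ.le]
  field_simp

/-- Two conjugate Abel kernels compose to a constant, by `integral_rpow_mul_rpow`. The condition b ≤
β ensures that the integration covers all of (β, r]. -/
lemma setIntegral_abel_weight {b r x p : ℝ} (hb : 0 ≤ b) (hx : 0 < x) (hp : 0 < p)
    (hr : 0 ≤ r) (hbx : b ≤ (x / p) ^ (2 / α)) :
    IntegrableOn (fun τ => (r - τ) ^ (α - 1) * (τ ^ (-α) * weight α (x / (p * τ ^ (α / 2)))))
      (Ioc b r) ∧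
    ∫ τ in Ioc b r, (r - τ) ^ (α - 1) * (τ ^ (-α) * weight α (x / (p * τ ^ (α / 2)))) =
      (Iio (p * r ^ (α / 2))).indicator (fun _ => Real.Gamma α) x := by
  set β := (x / p) ^ (2 / α)
  set g : ℝ → ℝ := fun τ =>
    1 / Real.Gamma (1 - α) * ((r - τ) ^ (α - 1) * (τ - β) ^ (-α))
  have heq : EqOn (fun τ => (r - τ) ^ (α - 1) * (τ ^ (-α) * weight α (x / (p * τ ^ (α / 2)))))
      ((Ioi β).indicator g) (Ioc b r) := by
    intro τ hτ
    simp only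
    rw [rpow_neg_mul_weight hα₀ hx hp (hb.trans_lt hτ.1)]
    by_cases h : τ ∈ Ioi β
    · rw [indicator_of_mem h, indicator_of_mem h]; simp only [g]; ring
    · rw [indicator_of_notMem h, indicator_of_notMem h, mul_zero]
  have hset : Ioc b r ∩ Ioi β = Ioc β r := by
    ext τ; constructor
    · exact fun h => ⟨h.2, h.1.2⟩
    · exact fun h => ⟨⟨hbx.trans_lt h.1, h.2⟩, h.1⟩
  have hset' : Ioi β ∩ Ioc b r = Ioc β r := by rw [inter_comm, hset]
  have hgi : IntegrableOn g (Ioc β r) := by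
    rcases lt_or_ge β r with h | h
    · exact ((intervalIntegrable_iff_integrableOn_Ioc_of_le h.le).1
        (intervalIntegrable_rpow_mul_rpow hα₀ hα₁ h)).const_mul _
    · rw [Ioc_eq_empty (not_lt.2 h)]; exact integrableOn_empty
  constructor
  · refine IntegrableOn.congr_fun ?_ heq.symm measurableSet_Ioc
    rw [IntegrableOn, integrable_indicator_iff measurableSet_Ioi, IntegrableOn,
      Measure.restrict_restrict measurableSet_Ioi, hset']
    exact hgi
  · rw [setIntegral_congr_fun measurableSet_Ioc heq, setIntegral_indicator measurableSet_Ioi, hset]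
    rcases lt_or_ge β r with h | h
    · have h' := (rpow_lt_iff_lt_mul_rpow hα₀ hx.le hp hr).1 h
      rw [indicator_of_mem (mem_Iio.2 h'), ← intervalIntegral.integral_of_le h.le,
        intervalIntegral.integral_const_mul, integral_rpow_mul_rpow hα₀ hα₁ h]
      have : Real.Gamma (1 - α) ≠ 0 := (Real.Gamma_pos_of_pos (by linarith)).ne'
      field_simp
    · have h' := mt (rpow_lt_iff_lt_mul_rpow hα₀ hx.le hp hr).2 (not_lt.2 h)
      rw [indicator_of_notMem (by simpa using h'), Ioc_eq_empty (not_lt.2 h)]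
      simp

/-- After Fubini each x ∈ (a, p r^{α/2}) contributes Γ(α), so the value is Γ(α) times the length of
that interval. -/
lemma integral_abel_kern {a b p r : ℝ} (ha : 0 < a) (hb : 0 ≤ b) (hbr : b ≤ r) (hp : 0 < p)
    (hbp : b ≤ (a / p) ^ (2 / α)) :
    ∫ τ in b..r, (r - τ) ^ (α - 1) * (τ ^ (-(α / 2)) * kern α p (a * τ ^ (-(α / 2)))) =
      Real.Gamma α * max (p * r ^ (α / 2) - a) 0 := by
  have hr : 0 ≤ r := hb.trans hbr
  -- The maximum with `a` keeps the x-interval correctly oriented when p r^{α/2} < a, where the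
  -- result is 0.
  set q := max (p * r ^ (α / 2)) a
  have haq : a ≤ q := le_max_right _ _
  set F : ℝ → ℝ → ℝ := fun x τ =>
    (r - τ) ^ (α - 1) * (τ ^ (-α) * weight α (x / (p * τ ^ (α / 2))))
  have hin : ∀ x ∈ Ioc a q, IntegrableOn (F x) (Ioc b r) ∧
      ∫ τ in Ioc b r, F x τ = (Iio (p * r ^ (α / 2))).indicator (fun _ => Real.Gamma α) x := by
    intro x hx
    refine setIntegral_abel_weight hα₀ hα₁ hb (ha.trans hx.1) hp hr (hbp.trans ?_)
    have := hx.1.le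
    gcongr
  have h1 : ∫ τ in b..r, (r - τ) ^ (α - 1) * (τ ^ (-(α / 2)) * kern α p (a * τ ^ (-(α / 2)))) =
      ∫ τ in b..r, ∫ x in a..q, F x τ := by
    rw [intervalIntegral.integral_of_le hbr, intervalIntegral.integral_of_le hbr]
    refine setIntegral_congr_fun measurableSet_Ioc fun τ hτ => ?_
    simp only [F]
    rw [intervalIntegral.integral_const_mul, rpow_mul_kern hα₀ hα₁ hp (hb.trans_lt hτ.1)]
    refine le_trans ?_ (le_max_left _ _)
    have := hτ.2
    have := hb.trans_lt hτ.1
    gcongr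
  have hind : IntegrableOn ((Iio (p * r ^ (α / 2))).indicator fun _ => Real.Gamma α) (Ioc a q) := by
    refine IntegrableOn.indicator ?_ measurableSet_Iio
    exact integrableOn_const (by simp)
  rw [h1, ← intervalIntegral_intervalIntegral_swap]
  · rw [intervalIntegral.integral_of_le haq]
    simp_rw [intervalIntegral.integral_of_le hbr]
    rw [setIntegral_congr_fun measurableSet_Ioc fun x hx => (hin x hx).2,
      setIntegral_indicator measurableSet_Iio, setIntegral_const, smul_eq_mul, mul_comm]
    congr 1
    have : Ioc a q ∩ Iio (p * r ^ (α / 2)) = Ioo a (p * r ^ (α / 2)) := by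
      ext x; constructor
      · exact fun h => ⟨h.1.1, h.2⟩
      · exact fun h => ⟨⟨h.1, h.2.le.trans (le_max_left _ _)⟩, h.2⟩
    rw [this, Real.volume_real_Ioo]
  · rw [uIoc_of_le haq, uIoc_of_le hbr]
    refine integrableOn_prod_of_nonneg measurableSet_Ioc measurableSet_Ioc ?_ ?_
      (fun x hx => (hin x hx).1) hind (fun x hx => (hin x hx).2)
    · have hw := measurable_weight (α := α)
      refine Measurable.mul (by fun_prop) (Measurable.mul (by fun_prop) (hw.comp (by fun_prop)))
    · intro x _ τ hτ
      have := sub_nonneg.2 hτ.2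
      have := hb.trans hτ.1.le
      exact mul_nonneg (by positivity) (mul_nonneg (by positivity) (weight_nonneg hα₀ hα₁ _))

end

/-! ### The self-similar front and temperature -/

/-- The front `c t^{α/2}`. -/
def front (α c t : ℝ) : ℝ := c * t ^ (α / 2)

/-- The self-similar temperature. -/
def temp (α c x t : ℝ) : ℝ := profile α c (x * t ^ (-(α / 2)))

lemma mul_rpow_neg_le_iff {x c t : ℝ} (ht : 0 < t) :
    x * t ^ (-(α / 2)) ≤ c ↔ x ≤ front α c t := by
  rw [Real.rpow_neg ht.le, ← div_eq_mul_inv, div_le_iff₀ (Real.rpow_pos_of_pos ht _), front]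

lemma mul_rpow_neg_lt_iff {x c t : ℝ} (ht : 0 < t) :
    x * t ^ (-(α / 2)) < c ↔ x < front α c t := by
  rw [Real.rpow_neg ht.le, ← div_eq_mul_inv, div_lt_iff₀ (Real.rpow_pos_of_pos ht _), front]

lemma front_mul_rpow_neg {c t : ℝ} (ht : 0 < t) : front α c t * t ^ (-(α / 2)) = c := by
  rw [front, mul_assoc, ← Real.rpow_add ht, add_neg_cancel, Real.rpow_zero, mul_one]

lemma front_pos {c t : ℝ} (hc : 0 < c) (ht : 0 < t) : 0 < front α c t :=
  mul_pos hc (Real.rpow_pos_of_pos ht _)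

lemma hasDerivAt_front {c t : ℝ} (ht : 0 < t) :
    HasDerivAt (front α c) (c * (α / 2 * t ^ (α / 2 - 1))) t :=
  (Real.hasDerivAt_rpow_const (Or.inl ht.ne')).const_mul c

lemma hasDerivAt_mul_rpow_neg (x : ℝ) {t : ℝ} (ht : 0 < t) :
    HasDerivAt (fun t => x * t ^ (-(α / 2))) (-(x * (α / 2 * t ^ (-(α / 2) - 1)))) t :=
  ((Real.hasDerivAt_rpow_const (p := -(α / 2)) (Or.inl ht.ne')).const_mul x).congr_deriv (by ring)

lemma rpow_neg_half_mul_self {t : ℝ} (ht : 0 < t) :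
    t ^ (-(α / 2)) * t ^ (-(α / 2)) = t ^ (-α) := by
  rw [← Real.rpow_add ht]; congr 1; ring

section

variable (hα₀ : 0 < α)

include hα₀

lemma front_zero_eq (c : ℝ) : front α c 0 = 0 := by
  rw [front, Real.zero_rpow (by positivity), mul_zero]

lemma continuous_front (c : ℝ) : Continuous (front α c) :=
  continuous_const.mul (Real.continuous_rpow_const (by positivity))

lemma strictMonoOn_front {c : ℝ} (hc : 0 < c) : StrictMonoOn (front α c) (Ici 0) :=
  fun _ hx _ _ hxy => mul_lt_mul_of_pos_left (Real.rpow_lt_rpow hx hxy (by positivity)) hc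

lemma front_div_rpow {c x : ℝ} (hc : 0 < c) (hx : 0 ≤ x) : front α c ((x / c) ^ (2 / α)) = x := by
  rw [front, ← Real.rpow_mul (by positivity), mul_comm (2 / α), half_mul_two_div hα₀,
    Real.rpow_one, mul_div_cancel₀ _ hc.ne']

lemma frontTime_eq {c x : ℝ} (hc : 0 < c) (hx : 0 ≤ x) :
    frontTime (front α c) x = (x / c) ^ (2 / α) := by
  have h0 : (x / c) ^ (2 / α) ∈ Ici (0 : ℝ) := Real.rpow_nonneg (by positivity) _
  have h := (strictMonoOn_front hα₀ hc).injOn.leftInvOn_invFunOn h0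
  rwa [front_div_rpow hα₀ hc hx] at h

lemma frontTime_pos {c x : ℝ} (hc : 0 < c) (hx : 0 < x) : 0 < frontTime (front α c) x := by
  rw [frontTime_eq hα₀ hc hx.le]; positivity

lemma front_frontTime {c x : ℝ} (hc : 0 < c) (hx : 0 ≤ x) :
    front α c (frontTime (front α c) x) = x := by
  rw [frontTime_eq hα₀ hc hx, front_div_rpow hα₀ hc hx]

lemma mul_frontTime_rpow_neg {c x : ℝ} (hc : 0 < c) (hx : 0 < x) :
    x * frontTime (front α c) x ^ (-(α / 2)) = c := by
  have h := front_mul_rpow_neg (α := α) (c := c) (frontTime_pos hα₀ hc hx)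
  rwa [front_frontTime hα₀ hc hx.le] at h

lemma frontTime_lt_iff {c x t : ℝ} (hc : 0 < c) (hx : 0 ≤ x) (ht : 0 ≤ t) :
    frontTime (front α c) x < t ↔ x < front α c t := by
  rw [frontTime_eq hα₀ hc hx, rpow_lt_iff_lt_mul_rpow hα₀ hx hc ht, front]

lemma frontTime_le_iff {c x t : ℝ} (hc : 0 < c) (hx : 0 ≤ x) (ht : 0 ≤ t) :
    frontTime (front α c) x ≤ t ↔ x ≤ front α c t := by
  rw [frontTime_eq hα₀ hc hx,
    ← (strictMonoOn_front hα₀ hc).le_iff_le (mem_Ici.2 (by positivity)) (mem_Ici.2 ht),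
    front_div_rpow hα₀ hc hx]

variable (hα₁ : α < 1)

include hα₁

/-! ### Partial derivatives of the self-similar temperature. -/

lemma hasDerivAt_temp_space (c x t : ℝ) :
    HasDerivAt (fun y => temp α c y t)
      (-(t ^ (-(α / 2)) * resolvent α c (x * t ^ (-(α / 2))))) x :=
  ((hasDerivAt_profile hα₀ hα₁ c _).comp x
    ((hasDerivAt_id x).mul_const (t ^ (-(α / 2))))).congr_deriv (by simp; ring)

lemma hasDerivAt_temp_time (c x : ℝ) {t : ℝ} (ht : 0 < t) :
    HasDerivAt (fun τ => temp α c x τ)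
      (resolvent α c (x * t ^ (-(α / 2))) * (x * (α / 2 * t ^ (-(α / 2) - 1)))) t :=
  ((hasDerivAt_profile hα₀ hα₁ c _).comp t (hasDerivAt_mul_rpow_neg x ht)).congr_deriv (by ring)

lemma spaceDeriv_eq {c x t : ℝ} (hc : 0 < c) (ht : 0 < t) (hx : x ∈ Icc 0 (front α c t)) :
    spaceDeriv (front α c) (temp α c) x t =
      -(t ^ (-(α / 2)) * resolvent α c (x * t ^ (-(α / 2)))) :=
  (hasDerivAt_temp_space hα₀ hα₁ c x t).hasDerivWithinAt.derivWithin
    (uniqueDiffOn_Icc (front_pos hc ht) x hx)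

lemma timeDeriv_eq {c x t : ℝ} (hc : 0 < c) (hx : 0 < x)
    (ht : frontTime (front α c) x ≤ t) :
    timeDeriv (front α c) (temp α c) x t =
      resolvent α c (x * t ^ (-(α / 2))) * (x * (α / 2 * t ^ (-(α / 2) - 1))) :=
  (hasDerivAt_temp_time hα₀ hα₁ c x
    ((frontTime_pos hα₀ hc hx).trans_le ht)).hasDerivWithinAt.derivWithin
    (uniqueDiffOn_Ici _ t ht)

lemma continuousOn_timeDeriv {c x : ℝ} (hc : 0 < c) (hx : 0 < x) :
    ContinuousOn (fun τ => timeDeriv (front α c) (temp α c) x τ)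
      (Ici (frontTime (front α c) x)) := by
  refine ContinuousOn.congr ?_ fun t ht => timeDeriv_eq hα₀ hα₁ hc hx ht
  intro t ht
  have ht0 : t ≠ 0 := ((frontTime_pos hα₀ hc hx).trans_le ht).ne'
  refine ContinuousAt.continuousWithinAt (ContinuousAt.mul ?_ ?_)
  · exact (continuous_resolvent_right hα₀ hα₁ c).continuousAt.comp
      (continuousAt_const.mul (Real.continuousAt_rpow_const _ _ (Or.inl ht0)))
  · exact continuousAt_const.mul (continuousAt_const.mul
      (Real.continuousAt_rpow_const _ _ (Or.inl ht0)))

omit hα₀ hα₁ in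
lemma mul_rpow_neg_mem_Ioo {c x t : ℝ} (hx : 0 < x) (ht : 0 < t) (h : x < front α c t) :
    x * t ^ (-(α / 2)) ∈ Ioo 0 c :=
  ⟨by positivity, (mul_rpow_neg_lt_iff ht).2 h⟩

lemma hasDerivAt_spaceDeriv_formula {c x t : ℝ} (hx : 0 < x) (ht : 0 < t) (h : x < front α c t) :
    HasDerivAt (fun y => -(t ^ (-(α / 2)) * resolvent α c (y * t ^ (-(α / 2)))))
      (t ^ (-α) * (weight α (x * t ^ (-(α / 2)) / c) + memoryTerm α c (x * t ^ (-(α / 2))))) x :=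
  ((((hasDerivAt_resolvent hα₀ hα₁ (mul_rpow_neg_mem_Ioo hx ht h)).comp x
    ((hasDerivAt_id x).mul_const (t ^ (-(α / 2))))).const_mul (t ^ (-(α / 2)))).neg).congr_deriv (by
      rw [← rpow_neg_half_mul_self (α := α) ht]; ring)

lemma hasDerivAt_spaceDeriv {c x t : ℝ} (hc : 0 < c) (hx : 0 < x) (ht : 0 < t)
    (h : x < front α c t) :
    HasDerivAt (fun y => spaceDeriv (front α c) (temp α c) y t)
      (t ^ (-α) * (weight α (x * t ^ (-(α / 2)) / c) + memoryTerm α c (x * t ^ (-(α / 2))))) x := by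
  refine (hasDerivAt_spaceDeriv_formula hα₀ hα₁ hx ht h).congr_of_eventuallyEq ?_
  filter_upwards [Icc_mem_nhds hx h] with y hy
  exact spaceDeriv_eq hα₀ hα₁ hc ht hy

lemma spaceDeriv₂_eq {c x t : ℝ} (hc : 0 < c) (hx : 0 < x) (ht : 0 < t)
    (h : x < front α c t) :
    spaceDeriv₂ (front α c) (temp α c) x t =
      t ^ (-α) * (weight α (x * t ^ (-(α / 2)) / c) + memoryTerm α c (x * t ^ (-(α / 2)))) :=
  (hasDerivAt_spaceDeriv hα₀ hα₁ hc hx ht h).hasDerivWithinAt.derivWithin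
    (uniqueDiffOn_Icc (front_pos hc ht) x ⟨hx.le, h.le⟩)

/-! ### The Caputo derivative -/

lemma intervalIntegrable_caputo {c x t : ℝ} (hc : 0 < c) (hx : 0 < x)
    (ht : frontTime (front α c) x ≤ t) :
    IntervalIntegrable (fun τ => (t - τ) ^ (-α) * timeDeriv (front α c) (temp α c) x τ) volume
      (frontTime (front α c) x) t := by
  refine (intervalIntegrable_sub_rpow (by linarith) _ _).mul_continuousOn ?_
  refine (continuousOn_timeDeriv hα₀ hα₁ hc hx).mono ?_
  rw [uIcc_of_le ht]
  exact Icc_subset_Ici_self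

-- The ratio of the self-similar variables at times t and τ is (τ/t)^{α/2}, and its power 2/α is
-- τ/t. The weight thus becomes the Caputo kernel, and for τ = s⁻¹(x) it becomes the source term.
omit hα₁ in
lemma weight_div_self_similar {x t τ : ℝ} (hx : 0 < x) (hτ : 0 < τ) (h : τ < t) :
    weight α (x * t ^ (-(α / 2)) / (x * τ ^ (-(α / 2)))) =
      1 / Real.Gamma (1 - α) * (t ^ α * (t - τ) ^ (-α)) := by
  have ht : 0 < t := hτ.trans h
  have h1 : x * t ^ (-(α / 2)) / (x * τ ^ (-(α / 2))) = (τ / t) ^ (α / 2) := by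
    rw [mul_div_mul_left _ _ hx.ne', Real.div_rpow hτ.le ht.le, Real.rpow_neg ht.le,
      Real.rpow_neg hτ.le, div_inv_eq_mul, inv_mul_eq_div]
  have h2 : τ / t < 1 := (div_lt_one ht).2 h
  have h3 : 1 - τ / t = (t - τ) / t := by field_simp
  rw [h1, weight_of_mem ⟨by positivity, Real.rpow_lt_one (by positivity) h2 (by positivity)⟩,
    ← Real.rpow_mul (by positivity), half_mul_two_div hα₀, Real.rpow_one, h3,
    Real.div_rpow (sub_nonneg.2 h.le) ht.le, Real.rpow_neg ht.le, div_inv_eq_mul, mul_comm (t ^ α)]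

omit hα₀ hα₁ in
lemma memoryTerm_eq_of_pos {c z : ℝ} (hz : 0 < z) (h : z ≤ c) :
    memoryTerm α c z = ∫ p in z..c, weight α (z / p) * resolvent α c p := by
  rw [memoryTerm, intervalIntegral.integral_of_le (hz.le.trans h),
    intervalIntegral.integral_of_le h]
  refine setIntegral_eq_of_subset_of_forall_sdiff_eq_zero measurableSet_Ioc
    (Ioc_subset_Ioc_left hz.le) fun p hp => ?_
  rw [weight_of_one_le, zero_mul]
  rw [one_le_div hp.1.1]
  by_contra hlt
  exact hp.2 ⟨not_le.1 hlt, hp.1.2⟩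

lemma intervalIntegrable_weight_div_mul_resolvent {c z : ℝ} (hz : 0 < z) (h : z ≤ c) :
    IntervalIntegrable (fun p => weight α (z / p) * resolvent α c p) volume z c := by
  have h1 := (intervalIntegrable_weight_inv hα₀ hα₁ (L := c / z)
    (div_nonneg (hz.le.trans h) hz.le)).comp_mul_right (c := z⁻¹)
  rw [zero_div, div_inv_eq_mul, div_mul_cancel₀ _ hz.ne'] at h1
  have h2 : IntervalIntegrable (fun p => weight α (z / p)) volume 0 c := by
    refine h1.congr fun p _ => ?_
    rw [← div_eq_mul_inv, one_div_div]
  refine (h2.mono_set ?_).mul_continuousOn (continuous_resolvent_right hα₀ hα₁ c).continuousOn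
  rw [uIcc_of_le h, uIcc_of_le (hz.le.trans h)]
  exact Icc_subset_Icc_left hz.le

/-- The substitution p = xτ^{-α/2} carries [s⁻¹(x), t] onto [z, c] and turns u_t dτ into -N(c,p) dp.
-/
lemma caputoFront_eq {c x t : ℝ} (hc : 0 < c) (hx : 0 < x) (ht : 0 < t) (h : x < front α c t) :
    caputoFront α (front α c) (temp α c) x t =
      t ^ (-α) * memoryTerm α c (x * t ^ (-(α / 2))) := by
  have hz := mul_rpow_neg_mem_Ioo hx ht h
  set z := x * t ^ (-(α / 2)) with hzdef
  set b := frontTime (front α c) x with hb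
  have hb0 : 0 < b := frontTime_pos hα₀ hc hx
  have hbt : b < t := (frontTime_lt_iff hα₀ hc hx.le ht.le).2 h
  have hφb : x * b ^ (-(α / 2)) = c := mul_frontTime_rpow_neg hα₀ hc hx
  set φ : ℝ → ℝ := fun τ => x * τ ^ (-(α / 2)) with hφ
  set φ' : ℝ → ℝ := fun τ => -(x * (α / 2 * τ ^ (-(α / 2) - 1)))
  set g : ℝ → ℝ := fun p => weight α (z / p) * resolvent α c p with hg
  have hint : ∀ τ ∈ Ioo b t, (g ∘ φ) τ * φ' τ = -(1 / Real.Gamma (1 - α) * t ^ α) *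
      ((t - τ) ^ (-α) * timeDeriv (front α c) (temp α c) x τ) := by
    intro τ hτ
    rw [timeDeriv_eq hα₀ hα₁ hc hx hτ.1.le]
    simp only [Function.comp, g, φ, φ']
    rw [hzdef, weight_div_self_similar hα₀ hx (hb0.trans hτ.1) hτ.2]
    ring
  have hφmem : ∀ τ ∈ Icc b t, φ τ ∈ Icc z c := by
    intro τ hτ
    have hτ0 := hb0.trans_le hτ.1
    constructor
    · exact mul_le_mul_of_nonneg_left
        (Real.rpow_le_rpow_of_nonpos hτ0 hτ.2 (by linarith)) hx.le
    · rw [← hφb]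
      exact mul_le_mul_of_nonneg_left
        (Real.rpow_le_rpow_of_nonpos hb0 hτ.1 (by linarith)) hx.le
  have hφmem' : ∀ τ ∈ Ioo b t, φ τ ∈ Ioo z c := by
    intro τ hτ
    have hτ0 := hb0.trans hτ.1
    constructor
    · exact mul_lt_mul_of_pos_left
        (Real.rpow_lt_rpow_of_neg hτ0 hτ.2 (by linarith)) hx
    · rw [← hφb]
      exact mul_lt_mul_of_pos_left
        (Real.rpow_lt_rpow_of_neg hb0 hτ.1 (by linarith)) hx
  have hsub : ∫ τ in b..t, (g ∘ φ) τ * φ' τ = ∫ p in φ b..φ t, g p := by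
    refine intervalIntegral.integral_comp_mul_deriv''' ?_ ?_ ?_ ?_ ?_
    · rw [uIcc_of_le hbt.le]
      exact fun τ hτ => (hasDerivAt_mul_rpow_neg x
        (hb0.trans_le hτ.1)).continuousAt.continuousWithinAt
    · rw [min_eq_left hbt.le]
      exact fun τ hτ => (hasDerivAt_mul_rpow_neg x (hb0.trans hτ.1)).hasDerivWithinAt
    · rw [min_eq_left hbt.le, max_eq_right hbt.le]
      rintro _ ⟨τ, hτ, rfl⟩
      have hp := hφmem' τ hτ
      have hp0 := hz.1.trans hp.1
      refine ContinuousAt.continuousWithinAt (ContinuousAt.mul ?_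
        (continuous_resolvent_right hα₀ hα₁ c).continuousAt)
      exact ContinuousAt.comp (f := fun p => z / p)
        (continuousAt_weight hα₀ ⟨div_pos hz.1 hp0, (div_lt_one hp0).2 hp.1⟩)
        (continuousAt_const.div continuousAt_id hp0.ne')
    · have h1 := (intervalIntegrable_iff_integrableOn_Icc_of_le hz.2.le).1
        (intervalIntegrable_weight_div_mul_resolvent hα₀ hα₁ hz.1 hz.2.le)
      refine h1.mono_set ?_
      rw [uIcc_of_le hbt.le]
      rintro _ ⟨τ, hτ, rfl⟩
      exact hφmem τ hτ
    · rw [uIcc_of_le hbt.le, integrableOn_Icc_iff_integrableOn_Ioo]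
      have h1 := (intervalIntegrable_iff_integrableOn_Ioo_of_le hbt.le).1
        (intervalIntegrable_caputo hα₀ hα₁ hc hx hbt.le)
      exact IntegrableOn.congr_fun (h1.const_mul (-(1 / Real.Gamma (1 - α) * t ^ α)))
        (fun τ hτ => (hint τ hτ).symm) measurableSet_Ioo
  have hleft : ∫ τ in b..t, (g ∘ φ) τ * φ' τ =
      -(t ^ α * caputoFront α (front α c) (temp α c) x t) := by
    rw [caputoFront, ← hb, intervalIntegral.integral_of_le hbt.le, integral_Ioc_eq_integral_Ioo,
      setIntegral_congr_fun measurableSet_Ioo hint, integral_const_mul,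
      intervalIntegral.integral_of_le hbt.le, integral_Ioc_eq_integral_Ioo]
    ring
  -- The substitution is decreasing, so its reversed limits cancel the minus sign.
  rw [hleft, show φ b = c from hφb, show φ t = z from rfl, intervalIntegral.integral_symm,
    ← memoryTerm_eq_of_pos hz.1 hz.2.le, neg_inj] at hsub
  rw [← hsub, ← mul_assoc, ← Real.rpow_add ht, neg_add_cancel, Real.rpow_zero, one_mul]

lemma caputo_equation {c x t : ℝ} (hc : 0 < c) (hx : 0 < x) (ht : 0 < t)
    (h : x < front α c t) :
    caputoFront α (front α c) (temp α c) x t = spaceDeriv₂ (front α c) (temp α c) x t -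
      1 / Real.Gamma (1 - α) * (t - frontTime (front α c) x) ^ (-α) := by
  have hb0 := frontTime_pos hα₀ hc hx
  have hbt := (frontTime_lt_iff hα₀ hc hx.le ht.le).2 h
  have hw := weight_div_self_similar hα₀ hx hb0 hbt
  rw [mul_frontTime_rpow_neg hα₀ hc hx] at hw
  have ht' : t ^ (-α) * t ^ α = 1 := by
    rw [← Real.rpow_add ht, neg_add_cancel, Real.rpow_zero]
  rw [caputoFront_eq hα₀ hα₁ hc hx ht h, spaceDeriv₂_eq hα₀ hα₁ hc hx ht h, hw]
  linear_combination -(1 / Real.Gamma (1 - α) * (t - frontTime (front α c) x) ^ (-α)) * ht'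

end

/-! ### The memory integral and the Stefan condition -/

/-- The double primitive `∫_z^c (1 + v)` of the profile equation. -/
def enthalpy (α c z : ℝ) : ℝ :=
  (c - z) + ((∫ p in z..c, p * resolvent α c p) - z * profile α c z)

lemma enthalpy_self (c : ℝ) : enthalpy α c c = 0 := by
  simp [enthalpy, profile_self]

section

variable (hα₀ : 0 < α) (hα₁ : α < 1)

include hα₀ hα₁

lemma hasDerivAt_enthalpy (c z : ℝ) : HasDerivAt (enthalpy α c) (-(1 + profile α c z)) z := by
  have hcont : Continuous fun p => p * resolvent α c p :=
    continuous_id.mul (continuous_resolvent_right hα₀ hα₁ c)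
  have h1 : HasDerivAt (fun z => ∫ p in z..c, p * resolvent α c p) (-(z * resolvent α c z)) z :=
    intervalIntegral.integral_hasDerivAt_left (hcont.intervalIntegrable _ _)
      hcont.stronglyMeasurable.stronglyMeasurableAtFilter hcont.continuousAt
  exact (((hasDerivAt_id z).const_sub c).add
    (h1.sub ((hasDerivAt_id z).mul (hasDerivAt_profile hα₀ hα₁ c z)))).congr_deriv (by
      simp only [id_eq]; ring)

/-- The positive parts are the form in which `integral_abel_kern` delivers the contribution of each
p. -/
lemma enthalpy_eq {c z : ℝ} (hz : 0 ≤ z) (h : z ≤ c) :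
    enthalpy α c z = (c - z) + ∫ p in (0 : ℝ)..c, max (p - z) 0 * resolvent α c p := by
  have hr := continuous_resolvent_right hα₀ hα₁ c
  have hcont : Continuous fun p => max (p - z) 0 * resolvent α c p := by fun_prop
  rw [enthalpy, integral_eq_of_zero_left (b := z) hcont]
  · rw [profile, ← intervalIntegral.integral_const_mul, ← intervalIntegral.integral_sub]
    · congr 1
      refine intervalIntegral.integral_congr fun p hp => ?_
      rw [uIcc_of_le h] at hp
      simp only [max_eq_left (sub_nonneg.2 hp.1)]
      ring
    · exact (continuous_id.mul hr).intervalIntegrable _ _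
    · exact (continuous_const.mul hr).intervalIntegrable _ _
  · intro p hp
    rw [uIcc_of_le hz] at hp
    rw [max_eq_right (sub_nonpos.2 hp.2), zero_mul]

lemma continuousOn_selfSimilar_flux (c : ℝ) {a b r : ℝ} (hb : 0 < b) (hbr : b ≤ r) :
    ContinuousOn (fun τ => -(τ ^ (-(α / 2)) * resolvent α c (a * τ ^ (-(α / 2))))) (uIcc b r) := by
  intro τ hτ
  rw [uIcc_of_le hbr] at hτ
  have hτ0 : τ ≠ 0 := (hb.trans_le hτ.1).ne'
  have h1 := Real.continuousAt_rpow_const τ (-(α / 2)) (Or.inl hτ0)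
  exact (h1.mul ((continuous_resolvent_right hα₀ hα₁ c).continuousAt.comp
    (continuousAt_const.mul h1))).neg.continuousWithinAt

lemma intervalIntegrable_abel_kern {p a b r : ℝ} (hb : 0 < b) (hbr : b ≤ r) :
    IntervalIntegrable
      (fun τ => (r - τ) ^ (α - 1) * (τ ^ (-(α / 2)) * kern α p (a * τ ^ (-(α / 2)))))
      volume b r := by
  refine (intervalIntegrable_sub_rpow (by linarith) _ _).mul_continuousOn ?_
  intro τ hτ
  rw [uIcc_of_le hbr] at hτ
  have hτ0 : τ ≠ 0 := (hb.trans_le hτ.1).ne'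
  have h1 := Real.continuousAt_rpow_const τ (-(α / 2)) (Or.inl hτ0)
  exact (h1.mul ((continuous_iter_right hα₀ hα₁ 0 p).continuousAt.comp
    (continuousAt_const.mul h1))).continuousWithinAt

lemma memoryIntegrand_eqOn {c a r : ℝ} (hc : 0 < c) (ha : 0 < a)
    (hr : frontTime (front α c) a ≤ r) :
    EqOn (fun τ => (r - τ) ^ (α - 1) * -(τ ^ (-(α / 2)) * resolvent α c (a * τ ^ (-(α / 2)))))
      (fun τ => (r - τ) ^ (α - 1) * spaceDeriv (front α c) (temp α c) a τ)
      (uIcc (frontTime (front α c) a) r) := by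
  intro τ hτ
  rw [uIcc_of_le hr] at hτ
  have hτ0 := (frontTime_pos hα₀ hc ha).trans_le hτ.1
  simp only
  rw [spaceDeriv_eq hα₀ hα₁ hc hτ0 ⟨ha.le, (frontTime_le_iff hα₀ hc ha.le hτ0.le).1 hτ.1⟩]

lemma intervalIntegrable_memory {c a r : ℝ} (hc : 0 < c) (ha : 0 < a)
    (hr : frontTime (front α c) a ≤ r) :
    IntervalIntegrable (fun τ => (r - τ) ^ (α - 1) * spaceDeriv (front α c) (temp α c) a τ)
      volume (frontTime (front α c) a) r := by
  refine IntervalIntegrable.congr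
    (fun τ hτ => memoryIntegrand_eqOn hα₀ hα₁ hc ha hr (uIoc_subset_uIcc hτ)) ?_
  exact (intervalIntegrable_sub_rpow (by linarith) _ _).mul_continuousOn
    (continuousOn_selfSimilar_flux hα₀ hα₁ c (frontTime_pos hα₀ hc ha) hr)

/-- By `resolvent_eq_left` the flux is a superposition of self-similar first kernels: one with p =
c, the others weighted by N(c,p). Each has an explicit Abel integral. -/
lemma memoryIntegral_eq {c a r : ℝ} (hc : 0 < c) (ha : 0 < a) (h : a < front α c r) (hr0 : 0 < r) :
    memoryIntegral α (front α c) (temp α c) a r =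
      -(Real.Gamma α * (r ^ (α / 2) * enthalpy α c (a * r ^ (-(α / 2))))) := by
  set b := frontTime (front α c) a with hb
  have hb0 : 0 < b := frontTime_pos hα₀ hc ha
  have hbr : b ≤ r := ((frontTime_lt_iff hα₀ hc ha.le hr0.le).2 h).le
  have hbeq : b = (a / c) ^ (2 / α) := frontTime_eq hα₀ hc ha.le
  have hw := continuous_resolvent_right hα₀ hα₁ c
  have hz := mul_rpow_neg_mem_Ioo ha hr0 h
  -- The slower curves pτ^{α/2} with p ≤ c reach `a` no earlier than the front does.
  have hbp : ∀ p ∈ Ioc 0 c, b ≤ (a / p) ^ (2 / α) := by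
    intro p hp
    rw [hbeq]
    have := hp.1
    have := hp.2
    gcongr
  have hA : ∀ p ∈ Ioc 0 c, ∫ τ in b..r, (r - τ) ^ (α - 1) *
      (τ ^ (-(α / 2)) * kern α p (a * τ ^ (-(α / 2)))) =
        Real.Gamma α * (r ^ (α / 2) * max (p - a * r ^ (-(α / 2))) 0) := by
    intro p hp
    rw [integral_abel_kern hα₀ hα₁ ha hb0.le hbr hp.1 (hbp p hp)]
    have hl : 0 < r ^ (α / 2) := Real.rpow_pos_of_pos hr0 _
    rw [mul_max_of_nonneg _ _ hl.le, mul_zero, Real.rpow_neg hr0.le]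
    congr 2
    field_simp
  have hswap : ∫ τ in b..r, ∫ p in (0 : ℝ)..c, (r - τ) ^ (α - 1) *
      (τ ^ (-(α / 2)) * kern α p (a * τ ^ (-(α / 2)))) * resolvent α c p =
      ∫ p in (0 : ℝ)..c, Real.Gamma α * (r ^ (α / 2) * max (p - a * r ^ (-(α / 2))) 0) *
        resolvent α c p := by
    rw [← intervalIntegral_intervalIntegral_swap]
    · rw [intervalIntegral.integral_of_le hc.le, intervalIntegral.integral_of_le hc.le]
      refine setIntegral_congr_fun measurableSet_Ioc fun p hp => ?_
      rw [intervalIntegral.integral_mul_const, hA p hp]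
    · rw [uIoc_of_le hc.le, uIoc_of_le hbr]
      refine integrableOn_prod_of_nonneg (g := fun p => Real.Gamma α *
        (r ^ (α / 2) * max (p - a * r ^ (-(α / 2))) 0) * resolvent α c p)
        measurableSet_Ioc measurableSet_Ioc ?_ ?_ ?_ ?_ ?_
      · have hk := (continuous_kern hα₀ hα₁).measurable
        have h0 : Measurable fun q : ℝ × ℝ => a * q.2 ^ (-(α / 2)) := by fun_prop
        have h1 : Measurable fun q : ℝ × ℝ => kern α q.1 (a * q.2 ^ (-(α / 2))) :=
          hk.comp (measurable_fst.prodMk h0)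
        have h2 : Measurable fun q : ℝ × ℝ => (r - q.2) ^ (α - 1) := by fun_prop
        have h3 : Measurable fun q : ℝ × ℝ => q.2 ^ (-(α / 2)) := by fun_prop
        exact (h2.mul (h3.mul h1)).mul (hw.measurable.comp measurable_fst)
      · intro p _ τ hτ
        have := sub_nonneg.2 hτ.2
        have := hb0.le.trans hτ.1.le
        exact mul_nonneg (mul_nonneg (by positivity)
          (mul_nonneg (by positivity) (kern_nonneg hα₀ hα₁ _ _))) (resolvent_nonneg hα₀ hα₁ _ _)
      · intro p _
        exact ((intervalIntegrable_iff_integrableOn_Ioc_of_le hbr).1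
          (intervalIntegrable_abel_kern hα₀ hα₁ hb0 hbr)).mul_const _
      · refine (intervalIntegrable_iff_integrableOn_Ioc_of_le hc.le).1
          (Continuous.intervalIntegrable ?_ _ _)
        fun_prop
      · intro p hp
        rw [← hA p hp, intervalIntegral.integral_of_le hbr, integral_mul_const]
  have hsplit : ∀ τ, (r - τ) ^ (α - 1) *
      -(τ ^ (-(α / 2)) * resolvent α c (a * τ ^ (-(α / 2)))) =
      -((r - τ) ^ (α - 1) * (τ ^ (-(α / 2)) * kern α c (a * τ ^ (-(α / 2)))) +
        ∫ p in (0 : ℝ)..c, (r - τ) ^ (α - 1) *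
          (τ ^ (-(α / 2)) * kern α p (a * τ ^ (-(α / 2)))) * resolvent α c p) := by
    intro τ
    rw [resolvent_eq_left hα₀ hα₁ hc.le]
    simp_rw [mul_assoc]
    rw [intervalIntegral.integral_const_mul, intervalIntegral.integral_const_mul]
    ring
  have hint1 := intervalIntegrable_abel_kern hα₀ hα₁ (p := c) (a := a) hb0 hbr
  have hint2 := (intervalIntegrable_sub_rpow (κ := α - 1) (by linarith) b r).mul_continuousOn
    (continuousOn_selfSimilar_flux hα₀ hα₁ c (a := a) hb0 hbr)
  simp_rw [hsplit] at hint2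
  -- The superposition term is integrable as the difference between the negated flux integrand and
  -- the term p = c.
  have hint3 := hint2.neg.sub hint1
  simp only [Pi.neg_apply, neg_neg, add_sub_cancel_left] at hint3
  rw [memoryIntegral, ← hb, ← intervalIntegral.integral_congr
    (memoryIntegrand_eqOn hα₀ hα₁ hc ha hbr)]
  simp_rw [hsplit]
  rw [intervalIntegral.integral_neg, intervalIntegral.integral_add hint1 hint3, hswap,
    hA c ⟨hc, le_rfl⟩, enthalpy_eq hα₀ hα₁ hz.1.le hz.2.le, max_eq_left (sub_nonneg.2 hz.2.le)]
  simp_rw [mul_assoc]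
  rw [intervalIntegral.integral_const_mul, intervalIntegral.integral_const_mul]
  ring

lemma hasDerivAt_memoryIntegral {c a t : ℝ} (hc : 0 < c) (ha : 0 < a) (h : a < front α c t)
    (ht : 0 < t) :
    HasDerivAt (fun r => memoryIntegral α (front α c) (temp α c) a r)
      (-(Real.Gamma α * (α / 2 * t ^ (α / 2 - 1) * enthalpy α c (a * t ^ (-(α / 2))) +
        t ^ (α / 2) * ((1 + profile α c (a * t ^ (-(α / 2)))) *
          (a * (α / 2 * t ^ (-(α / 2) - 1))))))) t := by
  have h1 := (hasDerivAt_enthalpy hα₀ hα₁ c (a * t ^ (-(α / 2)))).comp t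
    (hasDerivAt_mul_rpow_neg (α := α) a ht)
  have h2 := ((Real.hasDerivAt_rpow_const (p := α / 2) (Or.inl ht.ne')).mul h1).const_mul
    (Real.Gamma α) |>.neg
  refine (h2.congr_of_eventuallyEq ?_).congr_deriv ?_
  · filter_upwards [(continuous_front hα₀ c).continuousAt.eventually (Ioi_mem_nhds h),
      Ioi_mem_nhds ht] with r hr hr0
    exact memoryIntegral_eq hα₀ hα₁ hc ha hr hr0
  · simp only [Function.comp]
    ring

/-- The derivative is continuous in a up to the front, where `enthalpy` and `profile` vanish; only
the constant in 1 + v is left. -/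
lemma tendsto_deriv_memoryIntegral {c t : ℝ} (hc : 0 < c) (ht : 0 < t) :
    Tendsto (fun a => deriv (fun r => memoryIntegral α (front α c) (temp α c) a r) t)
      (𝓝[<] (front α c t)) (𝓝 (-(Real.Gamma α * (c * (α / 2 * t ^ (α / 2 - 1)))))) := by
  have hv := continuous_profile hα₀ hα₁ c
  have he : Continuous (enthalpy α c) :=
    continuous_iff_continuousAt.2 fun x => (hasDerivAt_enthalpy hα₀ hα₁ c x).continuousAt
  have hcont : Continuous fun a : ℝ =>
      -(Real.Gamma α * (α / 2 * t ^ (α / 2 - 1) * enthalpy α c (a * t ^ (-(α / 2))) +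
        t ^ (α / 2) * ((1 + profile α c (a * t ^ (-(α / 2)))) *
          (a * (α / 2 * t ^ (-(α / 2) - 1)))))) := by fun_prop
  have h1 := (hcont.tendsto (front α c t)).mono_left (nhdsWithin_le_nhds (s := Iio (front α c t)))
  rw [front_mul_rpow_neg ht, enthalpy_self, profile_self] at h1
  have h2 : -(Real.Gamma α * (α / 2 * t ^ (α / 2 - 1) * 0 +
      t ^ (α / 2) * ((1 + 0) * (front α c t * (α / 2 * t ^ (-(α / 2) - 1)))))) =
      -(Real.Gamma α * (c * (α / 2 * t ^ (α / 2 - 1)))) := by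
    have h3 : t ^ (α / 2 - 1) = t ^ (α / 2) * (t ^ (α / 2) * t ^ (-(α / 2) - 1)) := by
      rw [← Real.rpow_add ht, ← Real.rpow_add ht]; congr 1; ring
    rw [h3, front]; ring
  rw [h2] at h1
  refine h1.congr' ?_
  filter_upwards [Ioo_mem_nhdsLT (front_pos hc ht)] with a ha
  exact (hasDerivAt_memoryIntegral hα₀ hα₁ hc ha.1 ha.2 ht).deriv.symm

end

/-! ### Regularity of the self-similar temperature -/

section

variable (hα₀ : 0 < α) (hα₁ : α < 1)

include hα₀ hα₁

lemma ac_spaceDeriv_space {c t : ℝ} (hc : 0 < c) (ht : 0 < t) :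
    IntervalIntegrable (fun x => t ^ (-α) * (weight α (x * t ^ (-(α / 2)) / c) +
      memoryTerm α c (x * t ^ (-(α / 2))))) volume 0 (front α c t) ∧
    AbsolutelyContinuousOnInterval (fun x => spaceDeriv (front α c) (temp α c) x t)
      0 (front α c t) := by
  have hs := front_pos (α := α) hc ht
  have hr := continuous_resolvent_right hα₀ hα₁ c
  have h := absolutelyContinuousOnInterval_of_deriv_nonneg hs.le
    (f := fun y => -(t ^ (-(α / 2)) * resolvent α c (y * t ^ (-(α / 2)))))
    (Continuous.continuousOn (by fun_prop))
    (fun x hx => hasDerivAt_spaceDeriv_formula hα₀ hα₁ hx.1 ht hx.2)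
    (fun x hx => mul_nonneg (by positivity)
      (add_nonneg (weight_nonneg hα₀ hα₁ _) (memoryTerm_nonneg hα₀ hα₁ hc.le _)))
  refine ⟨h.1, absolutelyContinuousOnInterval_congr h.2 fun x hx => ?_⟩
  rw [uIcc_of_le hs.le] at hx
  exact (spaceDeriv_eq hα₀ hα₁ hc ht hx).symm

lemma ac_temp_space {c t : ℝ} (hc : 0 < c) (ht : 0 < t) :
    AbsolutelyContinuousOnInterval (fun x => temp α c x t) 0 (front α c t) := by
  have h := (absolutelyContinuousOnInterval_of_deriv_nonneg (front_pos (α := α) hc ht).le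
    (f := fun x => -temp α c x t)
    (fun x _ => (hasDerivAt_temp_space hα₀ hα₁ c x t).neg.continuousAt.continuousWithinAt)
    (fun x _ => (hasDerivAt_temp_space hα₀ hα₁ c x t).neg)
    (fun x _ => by
      rw [neg_neg]
      exact mul_nonneg (by positivity) (resolvent_nonneg hα₀ hα₁ _ _))).2.neg
  exact absolutelyContinuousOnInterval_congr h fun x _ => neg_neg _

/-- Up to sign, u_x is the product of τ^{-α/2}, smooth away from 0, and N(c, xτ^{-α/2}), which is
nondecreasing in τ because both factors in its chain rule are nonpositive. -/
lemma ac_spaceDeriv_time {c x T : ℝ} (hc : 0 < c) (hx : 0 < x)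
    (hT : frontTime (front α c) x ≤ T) :
    AbsolutelyContinuousOnInterval (fun τ => spaceDeriv (front α c) (temp α c) x τ)
      (frontTime (front α c) x) T := by
  have hb := frontTime_pos hα₀ hc hx
  set b := frontTime (front α c) x
  have hr := continuous_resolvent_right hα₀ hα₁ c
  have h1 := (absolutelyContinuousOnInterval_of_deriv_nonneg hT
    (f := fun τ => resolvent α c (x * τ ^ (-(α / 2))))
    (f' := fun τ => -(weight α (x * τ ^ (-(α / 2)) / c) + memoryTerm α c (x * τ ^ (-(α / 2)))) *
      -(x * (α / 2 * τ ^ (-(α / 2) - 1))))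
    (fun τ hτ => (hr.continuousAt.comp
      (hasDerivAt_mul_rpow_neg x (hb.trans_le hτ.1)).continuousAt).continuousWithinAt)
    (fun τ hτ => by
      have hτ0 := hb.trans hτ.1
      exact (hasDerivAt_resolvent hα₀ hα₁ (mul_rpow_neg_mem_Ioo hx hτ0
        ((frontTime_lt_iff hα₀ hc hx.le hτ0.le).1 hτ.1))).comp τ (hasDerivAt_mul_rpow_neg x hτ0))
    (fun τ hτ => by
      have hτ0 := hb.trans hτ.1
      rw [neg_mul_neg]
      exact mul_nonneg (add_nonneg (weight_nonneg hα₀ hα₁ _) (memoryTerm_nonneg hα₀ hα₁ hc.le _))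
        (by positivity))).2
  have h2 : AbsolutelyContinuousOnInterval (fun τ : ℝ => τ ^ (-(α / 2))) b T := by
    refine ContDiffOn.absolutelyContinuousOnInterval fun τ hτ => ?_
    rw [uIcc_of_le hT] at hτ
    exact (Real.contDiffAt_rpow_const_of_ne (hb.trans_le hτ.1).ne').contDiffWithinAt
  refine absolutelyContinuousOnInterval_congr (h2.mul h1).neg fun τ hτ => ?_
  rw [uIcc_of_le hT] at hτ
  have hτ0 := hb.trans_le hτ.1
  rw [spaceDeriv_eq hα₀ hα₁ hc hτ0 ⟨hx.le, (frontTime_le_iff hα₀ hc hx.le hτ0.le).1 hτ.1⟩]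
  rfl

lemma memW21_temp {c t : ℝ} (hc : 0 < c) (ht : 0 < t) :
    MemW21 0 (front α c t) (fun x => temp α c x t) := by
  have hs := front_pos (α := α) hc ht
  have hint : ∀ f : ℝ → ℝ, Continuous f → IntegrableOn f (Ioo 0 (front α c t)) := fun f hf =>
    (hf.integrableOn_Icc (μ := volume)).mono_set Ioo_subset_Icc_self
  have hr := continuous_resolvent_right hα₀ hα₁ c
  have hv := continuous_profile hα₀ hα₁ c
  have hac := ac_spaceDeriv_space hα₀ hα₁ hc ht
  refine ⟨hint _ ?_, fun x => -(t ^ (-(α / 2)) * resolvent α c (x * t ^ (-(α / 2)))), _,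
    hint _ (by fun_prop), (intervalIntegrable_iff_integrableOn_Ioo_of_le hs.le).1 hac.1, ?_, ?_⟩
  · unfold temp; fun_prop
  · exact isWeakDeriv_of_absolutelyContinuous hs.le (ac_temp_space hα₀ hα₁ hc ht)
      fun x _ => hasDerivAt_temp_space hα₀ hα₁ c x t
  · refine isWeakDeriv_of_absolutelyContinuous hs.le
      (absolutelyContinuousOnInterval_congr hac.2 fun x hx => ?_)
      fun x hx => hasDerivAt_spaceDeriv_formula hα₀ hα₁ hx.1 ht hx.2
    rw [uIcc_of_le hs.le] at hx
    exact spaceDeriv_eq hα₀ hα₁ hc ht hx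

lemma integrableOn_timeDeriv {c t : ℝ} (hc : 0 < c) (ht : 0 < t) :
    IntegrableOn (fun x => timeDeriv (front α c) (temp α c) x t) (Ioo 0 (front α c t)) := by
  have hr := continuous_resolvent_right hα₀ hα₁ c
  have hf : Continuous fun x : ℝ =>
      resolvent α c (x * t ^ (-(α / 2))) * (x * (α / 2 * t ^ (-(α / 2) - 1))) := by fun_prop
  refine ((hf.integrableOn_Icc (μ := volume)).mono_set Ioo_subset_Icc_self).congr_fun
    (fun x hx => ?_) measurableSet_Ioo
  exact (timeDeriv_eq hα₀ hα₁ hc hx.1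
    ((frontTime_le_iff hα₀ hc hx.1.le ht.le).2 hx.2.le)).symm

lemma integrableOn_caputoFront {c t : ℝ} (hc : 0 < c) (ht : 0 < t) :
    IntegrableOn (fun x => caputoFront α (front α c) (temp α c) x t) (Ioo 0 (front α c t)) := by
  have h1 := (intervalIntegrable_iff_integrableOn_Ioo_of_le (front_pos (α := α) hc ht).le).1
    (ac_spaceDeriv_space hα₀ hα₁ hc ht).1
  have hne : t ^ (-(α / 2)) / c ≠ 0 := by positivity
  have h2 : Integrable fun x => t ^ (-α) * weight α (x * (t ^ (-(α / 2)) / c)) :=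
    ((integrable_weight hα₀ hα₁).comp_mul_right' hne).const_mul _
  -- By the equation, the Caputo derivative is u_xx minus the source term; both are integrable up to
  -- the front.
  refine (h1.sub h2.integrableOn).congr_fun (fun x hx => ?_) measurableSet_Ioo
  rw [caputoFront_eq hα₀ hα₁ hc hx.1 ht hx.2]
  simp only [Pi.sub_apply, mul_div_assoc]
  ring

lemma memLp_spaceDeriv_time {c x : ℝ} (hc : 0 < c) (hx : 0 < x) :
    MemLp (fun τ => spaceDeriv (front α c) (temp α c) x τ) ⊤
      (volume.restrict (Ioi (frontTime (front α c) x))) := by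
  have hb := frontTime_pos hα₀ hc hx
  set b := frontTime (front α c) x
  have hr := continuous_resolvent_right hα₀ hα₁ c
  have heq : EqOn (fun τ => -(τ ^ (-(α / 2)) * resolvent α c (x * τ ^ (-(α / 2)))))
      (fun τ => spaceDeriv (front α c) (temp α c) x τ) (Ioi b) := fun τ hτ =>
    (spaceDeriv_eq hα₀ hα₁ hc (hb.trans hτ)
      ⟨hx.le, (frontTime_le_iff hα₀ hc hx.le (hb.trans hτ).le).1 (le_of_lt hτ)⟩).symm
  have hcont : ContinuousOn (fun τ => -(τ ^ (-(α / 2)) * resolvent α c (x * τ ^ (-(α / 2)))))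
      (Ioi b) := by
    intro τ hτ
    have h1 := Real.continuousAt_rpow_const τ (-(α / 2)) (Or.inl (hb.trans hτ).ne')
    exact (h1.mul (hr.continuousAt.comp (continuousAt_const.mul h1))).neg.continuousWithinAt
  refine memLp_top_of_bound ((hcont.congr heq.symm).aestronglyMeasurable measurableSet_Ioi)
    (b ^ (-(α / 2)) * ∑' n, iterBound α (max c 0) n) ?_
  filter_upwards [ae_restrict_mem measurableSet_Ioi] with τ hτ
  have hτ0 : 0 < τ := hb.trans hτ
  rw [← show _ = spaceDeriv (front α c) (temp α c) x τ from heq hτ, norm_neg,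
    Real.norm_of_nonneg (mul_nonneg (by positivity) (resolvent_nonneg hα₀ hα₁ _ _))]
  exact mul_le_mul (Real.rpow_le_rpow_of_nonpos hb (le_of_lt hτ) (by linarith))
    (resolvent_le hα₀ hα₁ _ _) (resolvent_nonneg hα₀ hα₁ _ _) (by positivity)

omit hα₁ in
lemma ac_front {c T : ℝ} (hc : 0 < c) (hT : 0 ≤ T) :
    AbsolutelyContinuousOnInterval (front α c) 0 T :=
  (absolutelyContinuousOnInterval_of_deriv_nonneg hT (continuous_front hα₀ c).continuousOn
    (fun _ ht => hasDerivAt_front ht.1)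
    (fun t ht => by have := ht.1; positivity)).2

lemma memLp_deriv_front {c δ T : ℝ} (hc : 0 < c) (hδ : 0 < δ) :
    MemLp (deriv (front α c)) ⊤ (volume.restrict (Icc δ T)) := by
  refine memLp_top_of_bound (measurable_deriv _).aestronglyMeasurable
    (c * (α / 2 * δ ^ (α / 2 - 1))) ?_
  filter_upwards [ae_restrict_mem measurableSet_Icc] with t ht
  have ht0 := hδ.trans_le ht.1
  rw [(hasDerivAt_front ht0).deriv, Real.norm_of_nonneg (by positivity)]
  have := Real.rpow_le_rpow_of_nonpos hδ ht.1 (show α / 2 - 1 ≤ 0 by linarith)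
  gcongr

/-! ### Assembly of the solution and of its regularity assumptions. -/

lemma isStefanSolution_temp {c γ : ℝ} (hc : 0 < c)
    (hγ : ∫ y in (0 : ℝ)..c, resolvent α c y = γ) :
    IsStefanSolution α γ (temp α c) (front α c) where
  front_zero := front_zero_eq hα₀ c
  front_continuous := (continuous_front hα₀ c).continuousOn
  front_strictMono := strictMonoOn_front hα₀ hc
  front_differentiable _ ht := (hasDerivAt_front ht).differentiableAt
  temp_continuous := by
    intro q hq
    refine ContinuousAt.continuousWithinAt ?_
    refine (continuous_profile hα₀ hα₁ c).continuousAt.comp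
      (f := fun q : ℝ × ℝ => q.1 * q.2 ^ (-(α / 2))) (continuousAt_fst.mul ?_)
    exact continuousAt_snd.rpow_const (Or.inl hq.1.ne')
  time_differentiable x _ h := (hasDerivAt_temp_time hα₀ hα₁ c x h.1).differentiableAt
  space_differentiable x t _ := (hasDerivAt_temp_space hα₀ hα₁ c x t).differentiableAt
  space_differentiable₂ _ _ h :=
    (hasDerivAt_spaceDeriv hα₀ hα₁ hc h.2.1 h.1 h.2.2).differentiableAt
  caputo_integrable _ _ h := intervalIntegrable_caputo hα₀ hα₁ hc h.2.1
    ((frontTime_le_iff hα₀ hc h.2.1.le h.1.le).2 h.2.2.le)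
  equation _ _ h := caputo_equation hα₀ hα₁ hc h.2.1 h.1 h.2.2
  front_value t ht := by rw [temp, front_mul_rpow_neg ht, profile_self]
  dirichlet t _ := by rw [temp, zero_mul, profile, hγ]
  memory_integrable _ _ h := intervalIntegrable_memory hα₀ hα₁ hc h.2.1
    ((frontTime_le_iff hα₀ hc h.2.1.le h.1.le).2 h.2.2.le)
  memory_differentiable _ _ h :=
    (hasDerivAt_memoryIntegral hα₀ hα₁ hc h.2.1 h.2.2 h.1).differentiableAt
  stefan t ht := by
    refine ⟨_, tendsto_deriv_memoryIntegral hα₀ hα₁ hc ht, ?_⟩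
    rw [(hasDerivAt_front ht).deriv]
    have := (Real.Gamma_pos_of_pos hα₀).ne'
    field_simp

lemma assumptionA2_temp {c T : ℝ} (hc : 0 < c) (hT : 0 < T) :
    AssumptionA2 (temp α c) (front α c) T where
  front_ac := ac_front hα₀ hc hT.le
  space_differentiable t _ x _ :=
    (hasDerivAt_temp_space hα₀ hα₁ c x t).differentiableAt.differentiableWithinAt
  time_differentiable _ ht x _ := (hasDerivAt_temp_time hα₀ hα₁ c x ht.1).differentiableAt
  ux_ac_time _ hx := ac_spaceDeriv_time hα₀ hα₁ hc hx.1
    ((frontTime_le_iff hα₀ hc hx.1.le hT.le).2 hx.2)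
  ux_ac_space t ht ε hε := by
    refine (ac_spaceDeriv_space hα₀ hα₁ hc ht.1).2.mono ?_
    rw [uIcc_of_le (sub_nonneg.2 hε.2.le), uIcc_of_le (front_pos hc ht.1).le]
    exact Icc_subset_Icc_right (sub_le_self _ hε.1.le)
  ut_integrable _ ht := integrableOn_timeDeriv hα₀ hα₁ hc ht.1

lemma assumptionA3_temp {c T : ℝ} (hc : 0 < c) : AssumptionA3 α (temp α c) (front α c) T where
  front_deriv_bounded _ hδ := memLp_deriv_front hα₀ hα₁ hc hδ.1
  caputo_integrable _ ht := integrableOn_caputoFront hα₀ hα₁ hc ht.1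

omit hα₁ in
lemma temp_scaling (c x : ℝ) {a l t : ℝ} (hl : 0 < l) (ht : 0 < t) :
    temp α c x t = temp α c (l ^ a * x) (l ^ (2 * a / α) * t) := by
  have h : (l ^ (2 * a / α) * t) ^ (-(α / 2)) = (l ^ a)⁻¹ * t ^ (-(α / 2)) := by
    rw [Real.mul_rpow (by positivity) ht.le, ← Real.rpow_mul hl.le, ← Real.rpow_neg hl.le]
    congr 2
    field_simp
  have hla : l ^ a ≠ 0 := (Real.rpow_pos_of_pos hl a).ne'
  rw [temp, temp, h]
  congr 1
  field_simp

lemma tendsto_spaceDeriv_front {c t : ℝ} (hc : 0 < c) (ht : 0 < t) :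
    Tendsto (fun x => spaceDeriv (front α c) (temp α c) x t) (𝓝[<] (front α c t)) (𝓝 0) := by
  have hr := continuous_resolvent_right hα₀ hα₁ c
  have hcont : Continuous fun x : ℝ =>
      -(t ^ (-(α / 2)) * resolvent α c (x * t ^ (-(α / 2)))) := by fun_prop
  have h := (hcont.tendsto (front α c t)).mono_left (nhdsWithin_le_nhds (s := Iio (front α c t)))
  rw [front_mul_rpow_neg ht, resolvent_of_le le_rfl, mul_zero, neg_zero] at h
  refine h.congr' ?_
  filter_upwards [Ioo_mem_nhdsLT (front_pos hc ht)] with x hx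
  exact (spaceDeriv_eq hα₀ hα₁ hc ht ⟨hx.1.le, hx.2.le⟩).symm

end

end FracStefan

end

theorem theorem2 (α : ℝ) (hα₀ : 0 < α) (hα₁ : α < 1) :
    -- the kernels: uniform convergence of the series and positivity
    (∀ R : ℝ, 0 < R →
      TendstoUniformlyOn
        (fun (k : ℕ) (q : ℝ × ℝ) => ∑ n ∈ Finset.Icc 1 k, FracStefan.kernelM α n q.1 q.2)
        (fun q : ℝ × ℝ => FracStefan.kernelN α q.1 q.2) atTop (FracStefan.triangle R)) ∧
    (∀ p y : ℝ, 0 ≤ y → y < p →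
      (∀ n : ℕ, 1 ≤ n → 0 < FracStefan.kernelM α n p y) ∧ 0 < FracStefan.kernelN α p y) ∧
    (∀ p : ℝ, 0 ≤ p → IntervalIntegrable (fun y => FracStefan.kernelN α p y) volume 0 p) ∧
    -- the self-similar solution
    ∀ γ : ℝ, 0 < γ → ∃ c₁ : ℝ, 0 < c₁ ∧ ∃ (u : ℝ → ℝ → ℝ) (s : ℝ → ℝ),
      FracStefan.IsStefanSolution α γ u s ∧
      (∀ t : ℝ, 0 ≤ t → s t = c₁ * t ^ (α / 2)) ∧
      (∀ y ∈ Icc 0 c₁, IntervalIntegrable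
        (fun p => FracStefan.kernelH α p y * FracStefan.sourceG α c₁ p) volume y c₁) ∧
      (∀ x t : ℝ, (x, t) ∈ FracStefan.closedLiquid s →
        u x t = FracStefan.selfSimilarTemp α c₁ x t) ∧
      (∀ x t : ℝ, (x, t) ∈ FracStefan.liquid s → 0 < u x t) ∧
      -- scaling invariance
      (∀ a l : ℝ, 0 < a → 0 < l → ∀ x t : ℝ, (x, t) ∈ FracStefan.closedLiquid s →
        u x t = u (l ^ a * x) (l ^ (2 * a / α) * t)) ∧
      -- the space derivative vanishes at the front
      (∀ t : ℝ, 0 < t →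
        HasDerivWithinAt (fun y => u y t) 0 (Icc 0 (s t)) (s t) ∧
        Tendsto (fun x => FracStefan.spaceDeriv s u x t) (𝓝[<] (s t)) (𝓝 0)) ∧
      -- regularity
      (∀ t : ℝ, 0 < t → FracStefan.MemW21 0 (s t) (fun x => u x t)) ∧
      (∀ x : ℝ, 0 < x →
        DifferentiableOn ℝ (fun τ => u x τ) (Ici (FracStefan.frontTime s x)) ∧
        ContinuousOn (fun τ => FracStefan.timeDeriv s u x τ) (Ici (FracStefan.frontTime s x))) ∧
      (∀ x : ℝ, 0 < x →
        MemLp (fun τ => FracStefan.spaceDeriv s u x τ) ⊤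
          (volume.restrict (Ioi (FracStefan.frontTime s x))) ∧
        ∀ T : ℝ, FracStefan.frontTime s x < T →
          AbsolutelyContinuousOnInterval (fun τ => FracStefan.spaceDeriv s u x τ)
            (FracStefan.frontTime s x) T) ∧
      (∀ t : ℝ, 0 < t →
        IntegrableOn (fun x => FracStefan.timeDeriv s u x t) (Ioo 0 (s t)) ∧
        IntegrableOn (fun x => FracStefan.caputoFront α s u x t) (Ioo 0 (s t))) ∧
      -- assumptions (A1), (A2), (A3)
      FracStefan.AssumptionA1 s ∧
      ∀ T : ℝ, 0 < T → FracStefan.AssumptionA2 u s T ∧ FracStefan.AssumptionA3 α u s T := by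
  refine ⟨fun R hR => FracStefan.tendstoUniformlyOn_kernelM hα₀ hα₁ hR, fun p y hy h => ⟨?_, ?_⟩,
    fun p hp => ?_, fun γ hγ => ?_⟩
  · intro n hn
    obtain ⟨n, rfl⟩ := Nat.exists_eq_add_of_le' hn
    rw [FracStefan.kernelM_succ_eq hα₀ hα₁ n hy h.le]
    exact FracStefan.iter_pos hα₀ hα₁ n hy h
  · rw [FracStefan.kernelN_eq hα₀ hα₁ hy h.le]
    exact FracStefan.resolvent_pos hα₀ hα₁ hy h
  · refine ContinuousOn.intervalIntegrable (ContinuousOn.congr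
      (FracStefan.continuous_resolvent_right hα₀ hα₁ p).continuousOn fun y hy => ?_)
    rw [uIcc_of_le hp] at hy
    exact FracStefan.kernelN_eq hα₀ hα₁ hy.1 hy.2
  obtain ⟨c, hc, hcγ⟩ := FracStefan.exists_integral_resolvent_eq hα₀ hα₁ hγ
  refine ⟨c, hc, FracStefan.temp α c, FracStefan.front α c,
    FracStefan.isStefanSolution_temp hα₀ hα₁ hc hcγ, fun t _ => rfl,
    fun y hy => FracStefan.intervalIntegrable_kernelH_mul_sourceG hα₀ hα₁ hy.1 hy.2,
    fun x t h => ?_, fun x t h => ?_,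
    fun a l _ hl x t h => FracStefan.temp_scaling hα₀ c x hl h.1,
    fun t ht => ⟨?_, FracStefan.tendsto_spaceDeriv_front hα₀ hα₁ hc ht⟩,
    fun t ht => FracStefan.memW21_temp hα₀ hα₁ hc ht,
    fun x hx => ⟨fun t ht => ?_, FracStefan.continuousOn_timeDeriv hα₀ hα₁ hc hx⟩,
    fun x hx => ⟨FracStefan.memLp_spaceDeriv_time hα₀ hα₁ hc hx,
      fun T hT => FracStefan.ac_spaceDeriv_time hα₀ hα₁ hc hx hT.le⟩,
    fun t ht => ⟨FracStefan.integrableOn_timeDeriv hα₀ hα₁ hc ht,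
      FracStefan.integrableOn_caputoFront hα₀ hα₁ hc ht⟩,
    fun t ht => ⟨(FracStefan.hasDerivAt_front ht).differentiableAt, ?_⟩,
    fun T hT => ⟨FracStefan.assumptionA2_temp hα₀ hα₁ hc hT,
      FracStefan.assumptionA3_temp hα₀ hα₁ hc⟩⟩
  · have ht := h.1
    have hx := h.2.1
    exact (FracStefan.integral_kernelH_mul_sourceG hα₀ hα₁ (by positivity)
      ((FracStefan.mul_rpow_neg_le_iff ht).2 h.2.2)).symm
  · have hz := FracStefan.mul_rpow_neg_mem_Ioo h.2.1 h.1 h.2.2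
    exact FracStefan.profile_pos hα₀ hα₁ hz.1.le hz.2
  · have h := FracStefan.hasDerivAt_temp_space hα₀ hα₁ c (FracStefan.front α c t) t
    rw [FracStefan.front_mul_rpow_neg ht, FracStefan.resolvent_of_le le_rfl, mul_zero,
      neg_zero] at h
    exact h.hasDerivWithinAt
  · exact (FracStefan.hasDerivAt_temp_time hα₀ hα₁ c x
      ((FracStefan.frontTime_pos hα₀ hc hx).trans_le ht)).differentiableAt.differentiableWithinAt
  · rw [(FracStefan.hasDerivAt_front ht).deriv]
    positivity
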